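/- Let $n\ge 2$ and $m\ge 1$ be integers, let $\mathbf B^n$ be the open unit ball of $\mathbb R^n$ and $\mathbf S^{n-1}=\partial\mathbf B^n$. For $-1<a<1$ let $\alpha\in(0,\pi)$ be the angle for which the polar cap $\{\eta\in\mathbf S^{n-1}:\angle(\zeta,\eta)\le\alpha\}$ (with any center $\zeta\in\mathbf S^{n-1}$) has surface measure equal to $c=\frac{a+1}{2}$ times the surface measure of $\mathbf S^{n-1}$, and put $$D_n(a)=\frac{2^{2-n}}{\sqrt\pi}\,\frac{\Gamma(n/2)}{\Gamma((n-1)/2)}\int_{\alpha}^{\pi}\frac{\sin^{n-2}t}{\sin^{n}(t/2)}\,dt .$$ Let $x_0\in\mathbf S^{n-1}$ and $y_0\in\mathbf S^{m-1}$. Let $f:\mathbf B^n\to\mathbf B^m$ be a harmonic map with $f(0)=a_0$ that extends continuously to $x_0$ with $f(x_0)=y_0$, and let $a=\langle a_0,y_0\rangle$. Then $$\limsup_{r\to1^-}|D_rf(rx_0)|\ \ge\ D_n(a),$$ where $D_rf(x)=Df(x)\frac{x}{|x|}$ is the radial derivative and the upper limit may be $+\infty$. If, in addition, this extension is differentiable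 at $x_0$, that is, if there is a linear map $Df(x_0):\mathbb R^n\to\mathbb R^m$ with $f(x)=y_0+Df(x_0)(x-x_0)+o(|x-x_0|)$ as $x\to x_0$ in $\mathbf B^n$, then there is a real number $\lambda>0$ such that $$Df(x_0)^*y_0=\lambda x_0\qquad\text{and}\qquad \lambda\ge D_n(a).$$ Both bounds are sharp: for every $a\in(-1,1)$ there is a harmonic map $f:\mathbf B^n\to\mathbf B^m$ with $\langle f(0),y_0\rangle=a$ that has an extension to a neighborhood of $x_0$ which takes the value $y_0$ at $x_0$ and is differentiable at $x_0$, and for which $\limsup_{r\to1^-}|D_rf(rx_0)|=D_n(a)$ and $Df(x_0)^*y_0=D_n(a)\,x_0$. -/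

import Mathlib

open Set Filter Topology MeasureTheory InnerProductSpace

noncomputable section

/-- The usual (unnormalized) surface measure on the unit sphere of `ℝⁿ`. -/
def surfaceMeasure (n : ℕ) : Measure (Metric.sphere (0 : EuclideanSpace ℝ (Fin n)) 1) :=
  (volume : Measure (EuclideanSpace ℝ (Fin n))).toSphere

/-- The polar cap of the unit sphere with center `ζ` and spherical angle `α`. -/
def polarCap {n : ℕ} (ζ : Metric.sphere (0 : EuclideanSpace ℝ (Fin n)) 1) (α : ℝ) :
    Set (Metric.sphere (0 : EuclideanSpace ℝ (Fin n)) 1) :=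
  {η | InnerProductGeometry.angle (ζ : EuclideanSpace ℝ (Fin n)) η ≤ α}

/-- The spherical angle `α(c) ∈ [0, π]` of the polar caps that fill the fraction `c` of the
unit sphere of `ℝⁿ`. For `2 ≤ n` and `0 ≤ c ≤ 1` the set below has exactly one element. -/
def capAngle (n : ℕ) (c : ℝ) : ℝ :=
  sSup {α : ℝ | α ∈ Icc 0 Real.pi ∧
    ∀ ζ : Metric.sphere (0 : EuclideanSpace ℝ (Fin n)) 1,
      (surfaceMeasure n).real (polarCap ζ α) = c * (surfaceMeasure n).real univ}

/-- The constant `D_n(a)`, for `2 ≤ n` and `-1 < a < 1`. -/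
def schwarzConst (n : ℕ) (a : ℝ) : ℝ :=
  (2 : ℝ) ^ (2 - (n : ℤ)) / Real.sqrt Real.pi *
    (Real.Gamma ((n : ℝ) / 2) / Real.Gamma (((n : ℝ) - 1) / 2)) *
    ∫ t in (capAngle n ((a + 1) / 2))..Real.pi, Real.sin t ^ (n - 2) / Real.sin (t / 2) ^ n

/-- The radial derivative `D_r f` at a point `x ≠ 0`: the derivative in the direction `x / |x|`. -/
def radialDeriv {n m : ℕ} (f : EuclideanSpace ℝ (Fin n) → EuclideanSpace ℝ (Fin m))
    (x : EuclideanSpace ℝ (Fin n)) : EuclideanSpace ℝ (Fin m) :=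
  fderiv ℝ f x (‖x‖⁻¹ • x)

/-- The upper limit, as `r → 1⁻`, of `|D_r f (r x₀)|`, with value in the extended reals. -/
def limsupRadialDeriv {n m : ℕ} (f : EuclideanSpace ℝ (Fin n) → EuclideanSpace ℝ (Fin m))
    (x₀ : EuclideanSpace ℝ (Fin n)) : EReal :=
  limsup (fun r : ℝ => ((‖radialDeriv f (r • x₀)‖ : ℝ) : EReal)) (𝓝[<] (1 : ℝ))

/-- `f` restricts to a harmonic map of the open unit ball of `ℝⁿ` into that of `ℝᵐ`. -/
def IsHarmonicBallMap {n m : ℕ}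
    (f : EuclideanSpace ℝ (Fin n) → EuclideanSpace ℝ (Fin m)) : Prop :=
  HarmonicOnNhd f (Metric.ball 0 1) ∧ MapsTo f (Metric.ball 0 1) (Metric.ball 0 1)

end

/-!
Pairing `f` with `y₀` reduces the bounds to a real harmonic function `u` on the ball with `|u| < 1`,
`u 0 = a` and boundary value `1` at `x₀`. The Poisson formula for the dilates of `u` writes
`u (r x₀)` as the integral of the boundary values against a kernel that decreases in the polar angle
from `x₀`. Among all boundary functions with values in `[-1, 1]` and mean `a`, the integral is
therefore largest for the one that is `1` on the polar cap of relative measure `(a + 1) / 2` around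
`x₀` and `-1` elsewhere. This gives `u (r x₀) ≤ U (r x₀)` for the Poisson integral `U` of that
function (`HarmonicOnNhd.le_capPoisson`).

Written as `1` minus an integral over the complement of the cap, `U` is harmonic on a neighborhood
of `x₀`, with `U x₀ = 1` and gradient `D_n(a) x₀` there (`hasFDerivAt_capPoisson_center`,
`schwarzConst_eq`). So `(1 - u (r x₀)) / (1 - r)` is at least `(1 - U (r x₀)) / (1 - r)`, which tends
to `D_n(a)`. The mean value theorem on `[r, 1]` turns this into the bound for the upper limit, and if
`f` is differentiable at `x₀` the limit `r → 1` gives `λ ≥ D_n(a)`. That the gradient of `u` at `x₀`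
is a multiple of `x₀` holds since `u < 1` in the ball. The map `U • y₀` attains both bounds.

The potential theory needed is the Poisson formula in the ball of `ℝⁿ`
(`HarmonicOnNhd.eq_poissonIntegral`). It follows from the weak maximum principle
(`HarmonicOnNhd.le_of_le_sphere`), the harmonicity of Poisson integrals
(`harmonicOnNhd_poissonIntegral`), and the fact that the kernel has integral `1`
(`integral_ballPoissonKernel`). For the last one the integral is reduced to the polar angle, whose
distribution has density proportional to `sin ^ (n - 2)` (`map_angle_surfaceMeasure`), and the
resulting one-dimensional integral is computed by a substitution that goes back to Gauss
(`integral_sin_pow_mul_poisson`).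
-/

/-! ### Second derivatives along lines and the Laplacian -/

lemma laplacian_apply_eq_sum {n : ℕ} {F : Type*} [NormedAddCommGroup F] [NormedSpace ℝ F]
    (f : EuclideanSpace ℝ (Fin n) → F) (x : EuclideanSpace ℝ (Fin n)) :
    Laplacian.laplacian f x = ∑ i, fderiv ℝ (fderiv ℝ f) x (EuclideanSpace.basisFun (Fin n) ℝ i)
      (EuclideanSpace.basisFun (Fin n) ℝ i) := by
  rw [laplacian_eq_iteratedFDeriv_orthonormalBasis f (EuclideanSpace.basisFun (Fin n) ℝ)]
  simp [iteratedFDeriv_two_apply]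

section Lines

variable {E F : Type*} [NormedAddCommGroup E] [NormedSpace ℝ E]
  [NormedAddCommGroup F] [NormedSpace ℝ F]

lemma hasDerivAt_add_smul (x e : E) (t : ℝ) : HasDerivAt (fun t : ℝ => x + t • e) e t := by
  simpa using ((hasDerivAt_id t).smul_const e).const_add x

lemma ContDiffAt.eventually_hasDerivAt_line {f : E → F} {x : E} (hf : ContDiffAt ℝ 2 f x) (e : E) :
    ∀ᶠ t in 𝓝 (0 : ℝ), HasDerivAt (fun t : ℝ => f (x + t • e)) (fderiv ℝ f (x + t • e) e) t := by
  have h1 : ∀ᶠ y in 𝓝 x, DifferentiableAt ℝ f y :=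
    (hf.eventually (by simp)).mono fun y hy => hy.differentiableAt (by simp)
  have h2 : Tendsto (fun t : ℝ => x + t • e) (𝓝 0) (𝓝 x) := by
    have := (hasDerivAt_add_smul x e 0).continuousAt.tendsto
    simpa using this
  filter_upwards [h2.eventually h1] with t ht
  exact ht.hasFDerivAt.comp_hasDerivAt t (hasDerivAt_add_smul x e t)

lemma ContDiffAt.hasDerivAt_fderiv_line {f : E → F} {x : E} (hf : ContDiffAt ℝ 2 f x) (e : E) :
    HasDerivAt (fun t : ℝ => fderiv ℝ f (x + t • e) e) (fderiv ℝ (fderiv ℝ f) x e e) 0 := by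
  have h1 : DifferentiableAt ℝ (fderiv ℝ f) x :=
    (hf.fderiv_right (m := 1) (by norm_num)).differentiableAt (by simp)
  have h2 : HasFDerivAt (fderiv ℝ f) (fderiv ℝ (fderiv ℝ f) x) (x + (0 : ℝ) • e) := by
    simpa using h1.hasFDerivAt
  have h3 : HasDerivAt (fun t : ℝ => fderiv ℝ f (x + t • e)) (fderiv ℝ (fderiv ℝ f) x e) 0 :=
    h2.comp_hasDerivAt (0 : ℝ) (hasDerivAt_add_smul x e 0)
  exact (ContinuousLinearMap.apply ℝ F e).hasFDerivAt.comp_hasDerivAt (0 : ℝ) h3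

/-- The second derivative in a direction can be computed by differentiating twice along a line. -/
lemma ContDiffAt.fderiv_fderiv_eq_of_line {f : E → F} {x : E} (hf : ContDiffAt ℝ 2 f x) (e : E)
    {φ : ℝ → F} {c : F} (hφ : ∀ᶠ t in 𝓝 (0 : ℝ), HasDerivAt (fun t : ℝ => f (x + t • e)) (φ t) t)
    (hc : HasDerivAt φ c 0) : fderiv ℝ (fderiv ℝ f) x e e = c := by
  have h : φ =ᶠ[𝓝 0] fun t : ℝ => fderiv ℝ f (x + t • e) e := by
    filter_upwards [hφ, hf.eventually_hasDerivAt_line e] with t h1 h2 using h1.unique h2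
  exact (hf.hasDerivAt_fderiv_line e).unique (hc.congr_of_eventuallyEq h.symm)

/-- At a local maximum the second derivative in each direction is nonpositive. -/
lemma IsLocalMax.fderiv_fderiv_nonpos {f : E → ℝ} {x : E} (hm : IsLocalMax f x)
    (hf : ContDiffAt ℝ 2 f x) (e : E) : fderiv ℝ (fderiv ℝ f) x e e ≤ 0 := by
  by_contra! hpos
  set g : ℝ → ℝ := fun t => f (x + t • e)
  have hev := hf.eventually_hasDerivAt_line e
  have hg1 : deriv g =ᶠ[𝓝 0] fun t : ℝ => fderiv ℝ f (x + t • e) e := hev.mono fun t ht => ht.deriv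
  have hg2 : deriv (deriv g) 0 = fderiv ℝ (fderiv ℝ f) x e e := by
    rw [hg1.deriv_eq, (hf.hasDerivAt_fderiv_line e).deriv]
  have hc : ContinuousAt (fun t : ℝ => x + t • e) 0 := (hasDerivAt_add_smul x e 0).continuousAt
  have hmax : IsLocalMax g 0 := by
    have hm' : ∀ᶠ y in 𝓝 (x + (0 : ℝ) • e), f y ≤ f (x + (0 : ℝ) • e) := by
      rw [zero_smul, add_zero]; exact hm
    exact hc.tendsto.eventually hm'
  have hmin : IsLocalMin g 0 := isLocalMin_of_deriv_deriv_pos (hg2 ▸ hpos) hmax.deriv_eq_zero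
    hev.self_of_nhds.continuousAt
  -- `g` is then constant near `0`, so its second derivative vanishes.
  have hconst : g =ᶠ[𝓝 0] fun _ => g 0 := by
    filter_upwards [hmax, hmin] with t h1 h2 using le_antisymm h1 h2
  have : deriv (deriv g) 0 = 0 := by
    have h3 : deriv g =ᶠ[𝓝 0] fun _ => 0 := by
      filter_upwards [hconst.eventuallyEq_nhds] with t ht
      rw [ht.deriv_eq, deriv_const]
    rw [h3.deriv_eq, deriv_const]
  linarith

end Lines

/-! ### The weak maximum principle -/

lemma laplacian_norm_sq {n : ℕ} (x : EuclideanSpace ℝ (Fin n)) :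
    Laplacian.laplacian (fun y : EuclideanSpace ℝ (Fin n) => ‖y‖ ^ 2) x = 2 * n := by
  rw [laplacian_apply_eq_sum]
  have h : ∀ i, fderiv ℝ (fderiv ℝ fun y : EuclideanSpace ℝ (Fin n) => ‖y‖ ^ 2) x
      (EuclideanSpace.basisFun (Fin n) ℝ i) (EuclideanSpace.basisFun (Fin n) ℝ i) = 2 := by
    intro i
    set e := EuclideanSpace.basisFun (Fin n) ℝ i
    have hee : ‖e‖ = 1 := (EuclideanSpace.basisFun (Fin n) ℝ).norm_eq_one i
    refine (contDiff_norm_sq ℝ).contDiffAt.fderiv_fderiv_eq_of_line e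
      (φ := fun t => 2 * inner ℝ (x + t • e) e) (.of_forall fun t => ?_) ?_
    · exact (hasDerivAt_add_smul x e t).norm_sq
    · have := ((hasDerivAt_add_smul x e 0).inner ℝ (hasDerivAt_const 0 e)).const_mul 2
      simpa [hee] using this
  rw [Finset.sum_congr rfl fun i _ => h i]
  simp [mul_comm]

/-- The weak maximum principle on a ball. -/
lemma InnerProductSpace.HarmonicOnNhd.le_of_le_sphere {n : ℕ} (hn : 0 < n) {w : EuclideanSpace ℝ (Fin n) → ℝ}
    {ρ ε : ℝ} (hw : HarmonicOnNhd w (Metric.closedBall 0 ρ))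
    (hb : ∀ x, ‖x‖ = ρ → w x ≤ ε) {x : EuclideanSpace ℝ (Fin n)} (hx : ‖x‖ ≤ ρ) : w x ≤ ε := by
  by_contra! hlt
  -- For small `δ` the function `w + δ ‖·‖²` still has its maximum inside, where its Laplacian
  -- `2 n δ` would have to be nonpositive.
  obtain ⟨δ, hδ, hδ'⟩ : ∃ δ > 0, δ * ρ ^ 2 < w x - ε := by
    refine ⟨(w x - ε) / (2 * (ρ ^ 2 + 1)), by apply div_pos <;> nlinarith [sq_nonneg ρ], ?_⟩
    rw [div_mul_eq_mul_div, div_lt_iff₀ (by positivity)]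
    nlinarith [sq_nonneg ρ]
  set v : EuclideanSpace ℝ (Fin n) → ℝ := fun y => w y + δ * ‖y‖ ^ 2
  have hvc : ContinuousOn v (Metric.closedBall 0 ρ) :=
    hw.continuousOn.add (by fun_prop)
  obtain ⟨z, hz, hzmax⟩ := (isCompact_closedBall (0 : EuclideanSpace ℝ (Fin n)) ρ).exists_isMaxOn
    ⟨x, by simpa using hx⟩ hvc
  have hz' : ‖z‖ ≤ ρ := by simpa using hz
  have hvx : v x ≤ v z := hzmax (by simpa using hx)
  have hzlt : ‖z‖ < ρ := by
    refine lt_of_le_of_ne hz' fun heq => ?_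
    have h1 := hb z heq
    have h2 : 0 ≤ δ * ‖x‖ ^ 2 := by positivity
    simp only [v, heq] at hvx
    linarith
  have hloc : IsLocalMax v z := by
    have : Metric.closedBall (0 : EuclideanSpace ℝ (Fin n)) ρ ∈ 𝓝 z :=
      Filter.mem_of_superset (Metric.isOpen_ball.mem_nhds (by simpa using hzlt))
        Metric.ball_subset_closedBall
    exact hzmax.isLocalMax this
  have hwz := hw z hz
  have hsq : ContDiffAt ℝ 2 (fun y : EuclideanSpace ℝ (Fin n) => δ * ‖y‖ ^ 2) z :=
    contDiffAt_const.mul (contDiff_norm_sq ℝ).contDiffAt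
  have hv2 : ContDiffAt ℝ 2 v z := hwz.1.add hsq
  have hlap : Laplacian.laplacian v z ≤ 0 := by
    rw [laplacian_apply_eq_sum]
    exact Finset.sum_nonpos fun i _ => hloc.fderiv_fderiv_nonpos hv2 _
  have h1 : Laplacian.laplacian v z = δ * (2 * n) := by
    have := hwz.1.laplacian_add hsq
    have h2 : Laplacian.laplacian (fun y : EuclideanSpace ℝ (Fin n) => δ * ‖y‖ ^ 2) z
        = δ * (2 * n) := by
      have := laplacian_smul δ (contDiff_norm_sq ℝ (E := EuclideanSpace ℝ (Fin n)) (n := 2)).contDiffAt (x := z)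
      rw [laplacian_norm_sq] at this
      exact this
    have h3 := hwz.2.self_of_nhds
    simp only [Pi.zero_apply] at h3
    have h4 : v = w + fun y : EuclideanSpace ℝ (Fin n) => δ * ‖y‖ ^ 2 := rfl
    rw [h4, this, h2, h3, zero_add]
  have : 0 < δ * (2 * n) := by positivity
  linarith

/-! ### The Poisson kernel of the unit ball -/

/-- The Poisson kernel `(1 - |x|²) / |x - y|ⁿ` of the unit ball of `ℝⁿ`, normalized with respect to
the uniform probability measure on the sphere. It is defined for all `x` and `y`, and is used for
`|y| = 1`. -/
noncomputable def ballPoissonKernel {n : ℕ} (x y : EuclideanSpace ℝ (Fin n)) : ℝ :=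
  (1 - ‖x‖ ^ 2) * (‖x - y‖ ^ n)⁻¹

section Line

variable {E : Type*} [NormedAddCommGroup E] [InnerProductSpace ℝ E]

lemma hasDerivAt_norm_pow_inv_line {w e : E} {t : ℝ} (hw : w + t • e ≠ 0) (m : ℕ) :
    HasDerivAt (fun t : ℝ => (‖w + t • e‖ ^ m)⁻¹)
      (-m * inner ℝ (w + t • e) e * (‖w + t • e‖ ^ (m + 2))⁻¹) t := by
  have hpos : 0 < ‖w + t • e‖ := norm_pos_iff.2 hw
  have h1 : HasDerivAt (fun t : ℝ => ‖w + t • e‖ ^ 2) (2 * inner ℝ (w + t • e) e) t :=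
    (hasDerivAt_add_smul w e t).norm_sq
  have h2 : HasDerivAt (fun t : ℝ => ‖w + t • e‖) (inner ℝ (w + t • e) e / ‖w + t • e‖) t := by
    have := h1.sqrt (by positivity)
    simp only [Real.sqrt_sq (norm_nonneg _)] at this
    exact this.congr_deriv (by field_simp)
  refine ((h2.pow m).inv (pow_ne_zero m hpos.ne')).congr_deriv ?_
  rcases m with _ | m
  · simp
  · simp only [Nat.add_sub_cancel, Pi.pow_apply]
    field_simp
    ring

end Line

variable {n : ℕ}

lemma contDiffAt_ballPoissonKernel_uncurry {k : WithTop ℕ∞}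
    {p : EuclideanSpace ℝ (Fin n) × EuclideanSpace ℝ (Fin n)} (hp : p.1 ≠ p.2) :
    ContDiffAt ℝ k (fun p : EuclideanSpace ℝ (Fin n) × EuclideanSpace ℝ (Fin n) =>
      ballPoissonKernel p.1 p.2) p := by
  unfold ballPoissonKernel
  have h0 : p.1 - p.2 ≠ 0 := sub_ne_zero.2 hp
  refine (contDiffAt_const.sub (contDiffAt_fst.norm_sq ℝ)).mul
    (((contDiffAt_fst.sub contDiffAt_snd).norm ℝ h0).pow n |>.inv ?_)
  exact pow_ne_zero _ (norm_ne_zero_iff.2 h0)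

lemma contDiffAt_ballPoissonKernel {k : WithTop ℕ∞} {x y : EuclideanSpace ℝ (Fin n)} (h : x ≠ y) :
    ContDiffAt ℝ k (fun x => ballPoissonKernel x y) x :=
  (contDiffAt_ballPoissonKernel_uncurry (p := (x, y)) h).comp x
    (contDiffAt_id.prodMk contDiffAt_const)

lemma fderiv_fderiv_ballPoissonKernel {x y e : EuclideanSpace ℝ (Fin n)} (h : x ≠ y)
    (he : ‖e‖ = 1) :
    fderiv ℝ (fderiv ℝ fun x => ballPoissonKernel x y) x e e =
      -2 * (‖x - y‖ ^ n)⁻¹ + 4 * n * (inner ℝ x e * inner ℝ (x - y) e) * (‖x - y‖ ^ (n + 2))⁻¹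
      + (1 - ‖x‖ ^ 2) * (n * (n + 2) * inner ℝ (x - y) e ^ 2 * (‖x - y‖ ^ (n + 4))⁻¹
        - n * (‖x - y‖ ^ (n + 2))⁻¹) := by
  set w := x - y with hw
  have hw0 : w ≠ 0 := sub_ne_zero.2 h
  have hc : ContinuousAt (fun t : ℝ => w + t • e) 0 := (hasDerivAt_add_smul w e 0).continuousAt
  have hev : ∀ᶠ t in 𝓝 (0 : ℝ), w + t • e ≠ 0 :=
    hc.eventually_ne (by simpa using hw0)
  have hA : ∀ t : ℝ, HasDerivAt (fun t : ℝ => 1 - ‖x + t • e‖ ^ 2) (-2 * inner ℝ (x + t • e) e) t :=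
    fun t => ((hasDerivAt_add_smul x e t).norm_sq.const_sub 1).congr_deriv (by ring)
  have hB : ∀ (v : EuclideanSpace ℝ (Fin n)) (t : ℝ),
      HasDerivAt (fun t : ℝ => inner ℝ (v + t • e) e) 1 t := fun v t => by
    have := (hasDerivAt_add_smul v e t).inner ℝ (hasDerivAt_const t e)
    simpa [he] using this
  have hw1 : w + (0 : ℝ) • e ≠ 0 := by simpa using hw0
  refine (contDiffAt_ballPoissonKernel h).fderiv_fderiv_eq_of_line e
    (φ := fun t => -2 * inner ℝ (x + t • e) e * (‖w + t • e‖ ^ n)⁻¹ + (1 - ‖x + t • e‖ ^ 2) *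
      (-n * inner ℝ (w + t • e) e * (‖w + t • e‖ ^ (n + 2))⁻¹)) ?_ ?_
  · filter_upwards [hev] with t ht
    have := (hA t).mul (hasDerivAt_norm_pow_inv_line ht n)
    refine this.congr_of_eventuallyEq (.of_forall fun s => ?_)
    simp only [ballPoissonKernel, Pi.mul_apply, hw]
    congr 4
    abel
  · have h1 := (((hB x 0).const_mul (-2)).mul (hasDerivAt_norm_pow_inv_line hw1 n)).add
      ((hA 0).mul (((hB w 0).const_mul (-n : ℝ)).mul (hasDerivAt_norm_pow_inv_line hw1 (n + 2))))
    refine h1.congr_deriv ?_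
    simp only [zero_smul, add_zero, Pi.mul_apply]
    push_cast
    ring

lemma sum_inner_basisFun_mul (x y : EuclideanSpace ℝ (Fin n)) :
    ∑ i, inner ℝ x (EuclideanSpace.basisFun (Fin n) ℝ i) *
      inner ℝ y (EuclideanSpace.basisFun (Fin n) ℝ i) = inner ℝ x y := by
  rw [← (EuclideanSpace.basisFun (Fin n) ℝ).sum_inner_mul_inner x y]
  exact Finset.sum_congr rfl fun i _ => by rw [real_inner_comm y]

lemma laplacian_ballPoissonKernel {x y : EuclideanSpace ℝ (Fin n)} (h : x ≠ y) (hy : ‖y‖ = 1) :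
    Laplacian.laplacian (fun x => ballPoissonKernel x y) x = 0 := by
  have hN : ‖x - y‖ ≠ 0 := norm_ne_zero_iff.2 (sub_ne_zero.2 h)
  rw [laplacian_apply_eq_sum, Finset.sum_congr rfl fun i _ => fderiv_fderiv_ballPoissonKernel h
    ((EuclideanSpace.basisFun (Fin n) ℝ).norm_eq_one i)]
  simp only [Finset.sum_add_distrib, ← Finset.mul_sum, ← Finset.sum_mul, Finset.sum_sub_distrib,
    sum_inner_basisFun_mul, sq (inner ℝ (x - y) _), Finset.sum_const, Finset.card_univ,
    Fintype.card_fin, nsmul_eq_mul]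
  have h1 : inner ℝ (x - y) (x - y) = ‖x - y‖ ^ 2 := real_inner_self_eq_norm_sq _
  have h2 : inner ℝ x (x - y) = (‖x - y‖ ^ 2 + ‖x‖ ^ 2 - 1) / 2 := by
    rw [norm_sub_sq_real, hy, inner_sub_right, real_inner_self_eq_norm_sq]; ring
  rw [h1, h2]
  field_simp
  ring

/-! ### Differentiation of integrals of kernels that are smooth off the diagonal -/

/-- The unit sphere of `ℝⁿ`. -/
abbrev UnitSphere (n : ℕ) : Type := Metric.sphere (0 : EuclideanSpace ℝ (Fin n)) 1

section Param

variable {F : Type*} [NormedAddCommGroup F]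

/-- The open set of points that keep a positive distance from almost every point of the measure `ν`
on the unit sphere, that is, the complement of the support of `ν`. -/
def awayFrom (ν : Measure (UnitSphere n)) :
    Set (EuclideanSpace ℝ (Fin n)) :=
  {x | ∃ δ > 0, ∀ᵐ η : UnitSphere n ∂ν, δ ≤ dist x η}

lemma exists_ball_of_mem_awayFrom {ν : Measure (UnitSphere n)}
    {z : EuclideanSpace ℝ (Fin n)} (hz : z ∈ awayFrom ν) :
    ∃ δ > 0, ∀ᵐ η : UnitSphere n ∂ν, ∀ x ∈ Metric.closedBall z δ, δ ≤ dist x η := by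
  obtain ⟨δ, hδ, h⟩ := hz
  refine ⟨δ / 2, by positivity, h.mono fun η hη x hx => ?_⟩
  have := dist_triangle_left z (η : EuclideanSpace ℝ (Fin n)) x
  rw [Metric.mem_closedBall] at hx
  linarith

lemma isOpen_awayFrom (ν : Measure (UnitSphere n)) :
    IsOpen (awayFrom ν) := by
  rw [Metric.isOpen_iff]
  intro z hz
  obtain ⟨δ, hδ, h⟩ := exists_ball_of_mem_awayFrom hz
  exact ⟨δ, hδ, fun x hx => ⟨δ, hδ, h.mono fun η hη => hη x (Metric.ball_subset_closedBall hx)⟩⟩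

lemma ball_subset_awayFrom (ν : Measure (UnitSphere n)) :
    Metric.ball 0 1 ⊆ awayFrom ν := by
  intro x hx
  rw [mem_ball_zero_iff] at hx
  refine ⟨1 - ‖x‖, by linarith, .of_forall fun η => ?_⟩
  have h1 : ‖(η : EuclideanSpace ℝ (Fin n))‖ = 1 := norm_eq_of_mem_sphere η
  rw [dist_comm, dist_eq_norm]
  linarith [norm_sub_norm_le (η : EuclideanSpace ℝ (Fin n)) x]

lemma isOpen_offDiag :
    IsOpen {p : EuclideanSpace ℝ (Fin n) × EuclideanSpace ℝ (Fin n) | p.1 ≠ p.2} :=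
  isOpen_ne_fun continuous_fst continuous_snd

lemma aestronglyMeasurable_kernel
    {ν : Measure (UnitSphere n)}
    {G : EuclideanSpace ℝ (Fin n) × EuclideanSpace ℝ (Fin n) → F}
    (hG : ContinuousOn G {p | p.1 ≠ p.2}) {x : EuclideanSpace ℝ (Fin n)} (hx : x ∈ awayFrom ν) :
    AEStronglyMeasurable (fun η : UnitSphere n => G (x, η)) ν := by
  obtain ⟨δ, hδ, h⟩ := hx
  set A : Set (UnitSphere n) := {η | δ ≤ dist x η}
  have hA : MeasurableSet A :=
    (isClosed_le continuous_const (by fun_prop)).measurableSet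
  rw [← Measure.restrict_eq_self_of_ae_mem (s := A) h]
  refine ContinuousOn.aestronglyMeasurable (hG.comp (by fun_prop) fun η hη hxη => ?_) hA
  have : δ ≤ dist x η := hη
  simp only at hxη
  rw [← hxη, dist_self] at this
  linarith

lemma exists_bound_kernel {G : EuclideanSpace ℝ (Fin n) × EuclideanSpace ℝ (Fin n) → F}
    (hG : ContinuousOn G {p | p.1 ≠ p.2}) (z : EuclideanSpace ℝ (Fin n)) {δ : ℝ} (hδ : 0 < δ) :
    ∃ C, ∀ x ∈ Metric.closedBall z δ, ∀ η : UnitSphere n,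
      δ ≤ dist x η → ‖G (x, η)‖ ≤ C := by
  have hK : IsCompact ((Metric.closedBall z δ ×ˢ Metric.sphere (0 : EuclideanSpace ℝ (Fin n)) 1) ∩
      {p | δ ≤ dist p.1 p.2}) :=
    ((isCompact_closedBall z δ).prod (isCompact_sphere 0 1)).inter_right
      (isClosed_le continuous_const (by fun_prop))
  obtain ⟨C, hC⟩ := hK.exists_bound_of_continuousOn (hG.mono fun p hp hpp => by
    have : δ ≤ dist p.1 p.2 := hp.2
    rw [hpp, dist_self] at this
    linarith)
  exact ⟨C, fun x hx η h => hC (x, η) ⟨⟨hx, η.2⟩, h⟩⟩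

variable [NormedSpace ℝ F]

lemma integrable_kernel {ν : Measure (UnitSphere n)}
    {g : UnitSphere n → ℝ} (hg : Integrable g ν)
    {G : EuclideanSpace ℝ (Fin n) × EuclideanSpace ℝ (Fin n) → F}
    (hG : ContinuousOn G {p | p.1 ≠ p.2}) {x : EuclideanSpace ℝ (Fin n)} (hx : x ∈ awayFrom ν) :
    Integrable (fun η : UnitSphere n => g η • G (x, η)) ν := by
  obtain ⟨δ, hδ, h⟩ := exists_ball_of_mem_awayFrom hx
  obtain ⟨C, hC⟩ := exists_bound_kernel hG x hδ
  refine (hg.norm.mul_const C).mono (hg.1.smul (aestronglyMeasurable_kernel hG hx)) ?_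
  filter_upwards [h] with η hη
  have h1 := hC x (Metric.mem_closedBall_self hδ.le) η (hη x (Metric.mem_closedBall_self hδ.le))
  rw [norm_smul, Real.norm_eq_abs (‖g η‖ * C), abs_mul, abs_norm]
  gcongr
  exact h1.trans (le_abs_self C)

/-- The derivative of `G` in its first variable. -/
noncomputable def partialFst (G : EuclideanSpace ℝ (Fin n) × EuclideanSpace ℝ (Fin n) → F) :
    EuclideanSpace ℝ (Fin n) × EuclideanSpace ℝ (Fin n) → EuclideanSpace ℝ (Fin n) →L[ℝ] F :=
  fun p => (fderiv ℝ G p).comp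
    (ContinuousLinearMap.inl ℝ (EuclideanSpace ℝ (Fin n)) (EuclideanSpace ℝ (Fin n)))

lemma hasFDerivAt_partialFst {G : EuclideanSpace ℝ (Fin n) × EuclideanSpace ℝ (Fin n) → F}
    {k : WithTop ℕ∞} (hk : k ≠ 0) (hG : ContDiffOn ℝ k G {p | p.1 ≠ p.2})
    {x y : EuclideanSpace ℝ (Fin n)}
    (h : x ≠ y) : HasFDerivAt (fun x => G (x, y)) (partialFst G (x, y)) x :=
  (((hG.contDiffAt (isOpen_offDiag.mem_nhds (x := (x, y)) h)).differentiableAt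
    hk).hasFDerivAt).comp x (hasFDerivAt_prodMk_left x y)

lemma contDiffOn_partialFst {G : EuclideanSpace ℝ (Fin n) × EuclideanSpace ℝ (Fin n) → F}
    {k l : WithTop ℕ∞} (hkl : l + 1 ≤ k) (hG : ContDiffOn ℝ k G {p | p.1 ≠ p.2}) :
    ContDiffOn ℝ l (partialFst G) {p | p.1 ≠ p.2} :=
  (hG.fderiv_of_isOpen isOpen_offDiag hkl).clm_comp contDiffOn_const

theorem hasFDerivAt_integral_kernel
    {ν : Measure (UnitSphere n)}
    {g : UnitSphere n → ℝ} (hg : Integrable g ν)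
    {G : EuclideanSpace ℝ (Fin n) × EuclideanSpace ℝ (Fin n) → F}
    (hG : ContDiffOn ℝ 1 G {p | p.1 ≠ p.2}) {z : EuclideanSpace ℝ (Fin n)} (hz : z ∈ awayFrom ν) :
    HasFDerivAt (fun x => ∫ η : UnitSphere n, g η • G (x, η) ∂ν)
      (∫ η : UnitSphere n, g η • partialFst G (z, η) ∂ν) z := by
  obtain ⟨δ, hδ, h⟩ := exists_ball_of_mem_awayFrom hz
  have hG' : ContinuousOn (partialFst G) {p | p.1 ≠ p.2} :=
    (contDiffOn_partialFst (l := 0) (by simp) hG).continuousOn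
  obtain ⟨C, hC⟩ := exists_bound_kernel hG' z hδ
  refine hasFDerivAt_integral_of_dominated_of_fderiv_le (s := Metric.ball z δ)
    (F' := fun x η => g η • partialFst G (x, η)) (bound := fun η => ‖g η‖ * C)
    (Metric.ball_mem_nhds z hδ) ?_ (integrable_kernel hg hG.continuousOn hz)
    (hg.1.smul (aestronglyMeasurable_kernel hG' hz)) ?_ (hg.norm.mul_const C) ?_
  · filter_upwards [(isOpen_awayFrom ν).mem_nhds hz] with x hx
    exact hg.1.smul (aestronglyMeasurable_kernel hG.continuousOn hx)
  · filter_upwards [h] with η hη x hx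
    have hx' := Metric.ball_subset_closedBall hx
    rw [norm_smul]
    gcongr
    exact hC x hx' η (hη x hx')
  · filter_upwards [h] with η hη x hx
    have hne : x ≠ η := fun hxη => by
      have := hη x (Metric.ball_subset_closedBall hx)
      rw [hxη, dist_self] at this
      linarith
    exact (hasFDerivAt_partialFst one_ne_zero hG hne).const_smul (g η)

theorem contDiffOn_integral_kernel
    {ν : Measure (UnitSphere n)}
    {g : UnitSphere n → ℝ} (hg : Integrable g ν) (k : ℕ) :
    ∀ {F : Type*} [NormedAddCommGroup F] [NormedSpace ℝ F]
    {G : EuclideanSpace ℝ (Fin n) × EuclideanSpace ℝ (Fin n) → F},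
    ContDiffOn ℝ (k + 1 : ℕ) G {p | p.1 ≠ p.2} →
    ContDiffOn ℝ k (fun x => ∫ η : UnitSphere n,
      g η • G (x, η) ∂ν) (awayFrom ν) := by
  induction k with
  | zero =>
    intro F _ _ G hG
    rw [Nat.cast_zero, contDiffOn_zero]
    exact fun x hx => (hasFDerivAt_integral_kernel hg
      (hG.of_le (by simp)) hx).continuousAt.continuousWithinAt
  | succ k ih =>
    intro F _ _ G hG
    have h1 : ContDiffOn ℝ 1 G {p | p.1 ≠ p.2} := hG.of_le (by
      norm_cast; omega)
    have hder := fun x (hx : x ∈ awayFrom ν) => hasFDerivAt_integral_kernel hg h1 hx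
    rw [Nat.cast_succ, contDiffOn_succ_iff_fderiv_of_isOpen (isOpen_awayFrom ν)]
    refine ⟨fun x hx => (hder x hx).differentiableAt.differentiableWithinAt, by simp, ?_⟩
    refine (ih (contDiffOn_partialFst (l := (k + 1 : ℕ)) (by norm_cast) hG)).congr
      fun x hx => (hder x hx).fderiv

end Param

/-! ### Poisson integrals are harmonic -/

lemma contDiffOn_ballPoissonKernel {k : WithTop ℕ∞} :
    ContDiffOn ℝ k (fun p : EuclideanSpace ℝ (Fin n) × EuclideanSpace ℝ (Fin n) =>
      ballPoissonKernel p.1 p.2) {p | p.1 ≠ p.2} :=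
  fun _ hp => (contDiffAt_ballPoissonKernel_uncurry hp).contDiffWithinAt

/-- A Poisson integral is harmonic off the support of its boundary measure, also outside the
ball. -/
theorem harmonicOnNhd_poissonIntegral
    {ν : Measure (UnitSphere n)}
    {g : UnitSphere n → ℝ} (hg : Integrable g ν) :
    HarmonicOnNhd (fun x => ∫ η : UnitSphere n,
      g η • ballPoissonKernel x η ∂ν) (awayFrom ν) := by
  set G : EuclideanSpace ℝ (Fin n) × EuclideanSpace ℝ (Fin n) → ℝ :=
    fun p => ballPoissonKernel p.1 p.2
  have hG : ∀ {k : WithTop ℕ∞}, ContDiffOn ℝ k G {p | p.1 ≠ p.2} := contDiffOn_ballPoissonKernel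
  have hG' : ∀ {k : ℕ}, ContDiffOn ℝ k (partialFst G) {p | p.1 ≠ p.2} :=
    fun {k} => contDiffOn_partialFst (k := (k + 1 : ℕ)) (by norm_cast) hG
  have hG'' : ContDiffOn ℝ 0 (partialFst (partialFst G)) {p | p.1 ≠ p.2} :=
    contDiffOn_partialFst (k := (1 : ℕ)) (by norm_cast) hG'
  have hzero : ∀ z ∈ awayFrom ν, Laplacian.laplacian (fun x =>
      ∫ η : UnitSphere n, g η • G (x, η) ∂ν) z = 0 := by
    intro z hz
    have hfd : fderiv ℝ (fun x => ∫ η : UnitSphere n,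
        g η • G (x, η) ∂ν) =ᶠ[𝓝 z] fun x => ∫ η : UnitSphere n,
        g η • partialFst G (x, η) ∂ν := by
      filter_upwards [(isOpen_awayFrom ν).mem_nhds hz] with x hx
      exact (hasFDerivAt_integral_kernel hg hG hx).fderiv
    have hint := integrable_kernel hg hG''.continuousOn hz
    rw [laplacian_apply_eq_sum, hfd.fderiv_eq,
      (hasFDerivAt_integral_kernel hg (by exact_mod_cast hG' (k := 1)) hz).fderiv]
    simp_rw [ContinuousLinearMap.integral_apply hint]
    have happ : ∀ e : EuclideanSpace ℝ (Fin n), Integrable (fun η : UnitSphere n => (g η • partialFst (partialFst G) (z, η)) e) ν :=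
      fun e => (ContinuousLinearMap.apply ℝ _ e).integrable_comp hint
    simp_rw [ContinuousLinearMap.integral_apply (happ _)]
    have happ2 : ∀ e : EuclideanSpace ℝ (Fin n), Integrable (fun η : UnitSphere n =>
        (g η • partialFst (partialFst G) (z, η)) e e) ν :=
      fun e => (ContinuousLinearMap.apply ℝ _ e).integrable_comp (happ e)
    rw [← integral_finsetSum _ fun i _ => happ2 _]
    refine integral_eq_zero_of_ae ?_
    obtain ⟨δ, hδ, h⟩ := hz
    filter_upwards [h] with η hη
    have hne : z ≠ η := fun hxη => by
      rw [hxη, dist_self] at hη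
      linarith
    have hfd2 : fderiv ℝ (fun x => ballPoissonKernel x (η : EuclideanSpace ℝ (Fin n))) =ᶠ[𝓝 z]
        fun x => partialFst G (x, η) := by
      filter_upwards [isOpen_ne.mem_nhds hne] with x hx
      exact (hasFDerivAt_partialFst one_ne_zero hG hx).fderiv
    have hP := laplacian_ballPoissonKernel hne (by simp)
    rw [laplacian_apply_eq_sum, hfd2.fderiv_eq, (hasFDerivAt_partialFst
      (k := (1 : ℕ)) (by simp) hG' hne).fderiv] at hP
    simp only [smul_apply, ← Finset.smul_sum, hP, smul_zero, Pi.zero_apply]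
  intro x hx
  refine ⟨(contDiffOn_integral_kernel hg 2 hG).contDiffAt ((isOpen_awayFrom ν).mem_nhds hx), ?_⟩
  filter_upwards [(isOpen_awayFrom ν).mem_nhds hx] with z hz using hzero z hz

/-! ### The distribution of the polar angle on the sphere -/

/-- Integration of radial functions in polar coordinates, for the lower Lebesgue integral. -/
lemma lintegral_fun_norm_eq {V : Type*} [NormedAddCommGroup V] [NormedSpace ℝ V] [Nontrivial V]
    [FiniteDimensional ℝ V] [MeasurableSpace V] [BorelSpace V] (μ : Measure V) [μ.IsAddHaarMeasure]
    {f : ℝ → ENNReal} (hf : Measurable f) :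
    ∫⁻ x, f ‖x‖ ∂μ = μ.toSphere univ *
      ∫⁻ r in Ioi (0 : ℝ), ENNReal.ofReal (r ^ (Module.finrank ℝ V - 1)) * f r := by
  calc ∫⁻ x, f ‖x‖ ∂μ = ∫⁻ x : ({(0)}ᶜ : Set V), f (‖x.1‖) ∂(μ.comap (↑)) := by
        rw [lintegral_subtype_comap (measurableSet_singleton _).compl fun x ↦ f (‖x‖),
          restrict_compl_singleton]
    _ = ∫⁻ x, f x.2 ∂μ.toSphere.prod (.volumeIoiPow (Module.finrank ℝ V - 1)) := by
        simpa using μ.measurePreserving_homeomorphUnitSphereProd.lintegral_comp_emb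
          (Homeomorph.measurableEmbedding _) (f ∘ Subtype.val ∘ Prod.snd)
    _ = μ.toSphere univ * ∫⁻ x : Ioi (0 : ℝ), f x ∂.volumeIoiPow (Module.finrank ℝ V - 1) := by
        rw [lintegral_prod _ (by fun_prop)]
        simp [mul_comm]
    _ = _ := by
        rw [Measure.volumeIoiPow, lintegral_withDensity_eq_lintegral_mul _ (by fun_prop)
          (by fun_prop)]
        rw [← lintegral_subtype_comap measurableSet_Ioi
          fun r => ENNReal.ofReal (r ^ (Module.finrank ℝ V - 1)) * f r]
        rfl

/-- The measure-preserving splitting `(s, y) ↦ s ζ + y` of the space along a unit vector `ζ` and its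
orthogonal complement. -/
lemma measurePreserving_smul_add_orthogonal {V : Type*} [NormedAddCommGroup V]
    [InnerProductSpace ℝ V] [FiniteDimensional ℝ V] [MeasurableSpace V] [BorelSpace V]
    {ζ : V} (hζ : ‖ζ‖ = 1) :
    MeasurePreserving (fun p : ℝ × (ℝ ∙ ζ)ᗮ => p.1 • ζ + p.2) := by
  have horth : ∀ y : (ℝ ∙ ζ)ᗮ, inner ℝ ζ (y : V) = 0 :=
    fun y => Submodule.mem_orthogonal_singleton_iff_inner_right.1 y.2
  let T : WithLp 2 (ℝ × (ℝ ∙ ζ)ᗮ) →ₗᵢ[ℝ] V :=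
    { toFun := fun p => p.fst • ζ + p.snd
      map_add' := fun p q => by
        simp only [WithLp.add_fst, WithLp.add_snd, add_smul, Submodule.coe_add]; abel
      map_smul' := fun c p => by
        simp [smul_smul]
      norm_map' := fun p => by
        have h : ‖p.fst • ζ + (p.snd : V)‖ ^ 2 = ‖p‖ ^ 2 := by
          rw [WithLp.prod_norm_sq_eq_of_L2, norm_add_sq_real, real_inner_smul_left, horth,
            norm_smul, hζ]
          simp
        exact (sq_eq_sq₀ (norm_nonneg _) (norm_nonneg _)).1 h }
  have hfin : Module.finrank ℝ (WithLp 2 (ℝ × (ℝ ∙ ζ)ᗮ)) = Module.finrank ℝ V := by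
    have h0 : ζ ≠ 0 := by rintro rfl; simp at hζ
    rw [(WithLp.linearEquiv 2 ℝ (ℝ × (ℝ ∙ ζ)ᗮ)).finrank_eq, Module.finrank_prod,
      ← (ℝ ∙ ζ).finrank_add_finrank_orthogonal, finrank_span_singleton h0]
    simp
  exact (T.toLinearIsometryEquiv hfin).measurePreserving.comp
    (WithLp.volume_preserving_toLp ℝ (ℝ ∙ ζ)ᗮ)

/-- Polar coordinates in the upper half-plane. -/
lemma lintegral_upperHalfPlane_polar {f : ℝ × ℝ → ENNReal} (hf : Measurable f) :
    ∫⁻ s : ℝ, ∫⁻ ρ in Ioi (0 : ℝ), f (s, ρ) = ∫⁻ r in Ioi (0 : ℝ), ∫⁻ t in Ioo 0 Real.pi,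
      ENNReal.ofReal r * f (r * Real.cos t, r * Real.sin t) := by
  have h1 := lintegral_comp_polarCoord_symm
    ((univ ×ˢ Ioi (0 : ℝ)).indicator f)
  have h2 : ∫⁻ p, (univ ×ˢ Ioi (0 : ℝ)).indicator f p = ∫⁻ s : ℝ, ∫⁻ ρ in Ioi (0 : ℝ), f (s, ρ) := by
    rw [lintegral_indicator (MeasurableSet.univ.prod measurableSet_Ioi), Measure.volume_eq_prod,
      ← Measure.prod_restrict, lintegral_prod _ hf.aemeasurable, Measure.restrict_univ]
  rw [← h2, ← h1, polarCoord_target, Measure.volume_eq_prod, ← Measure.prod_restrict]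
  have hm : Measurable fun p : ℝ × ℝ => ENNReal.ofReal p.1 •
      (univ ×ˢ Ioi (0 : ℝ)).indicator f (polarCoord.symm p) := by
    have : Measurable ((univ ×ˢ Ioi (0 : ℝ)).indicator f) :=
      hf.indicator (MeasurableSet.univ.prod measurableSet_Ioi)
    refine (ENNReal.measurable_ofReal.comp measurable_fst).smul (this.comp continuous_polarCoord_symm.measurable)
  rw [lintegral_prod _ hm.aemeasurable]
  refine setLIntegral_congr_fun measurableSet_Ioi fun r hr => ?_
  have hr' : 0 < r := hr
  have hsub : Ioo 0 Real.pi ⊆ Ioo (-Real.pi) Real.pi :=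
    Ioo_subset_Ioo_left (by linarith [Real.pi_pos])
  rw [← lintegral_indicator measurableSet_Ioo, ← lintegral_indicator measurableSet_Ioo]
  refine lintegral_congr fun t => ?_
  simp only [indicator, polarCoord_symm_apply, mem_prod, mem_univ, true_and, mem_Ioi, smul_eq_mul]
  by_cases ht : t ∈ Ioo 0 Real.pi
  · rw [if_pos (hsub ht), if_pos (mul_pos hr' (Real.sin_pos_of_mem_Ioo ht)), if_pos ht]
  · rw [if_neg ht]
    by_cases ht' : t ∈ Ioo (-Real.pi) Real.pi
    · rw [if_pos ht', if_neg, mul_zero]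
      have h3 : t ≤ 0 := by
        by_contra! h
        exact ht ⟨h, ht'.2⟩
      have := Real.sin_nonpos_of_nonpos_of_neg_pi_le h3 ht'.1.le
      nlinarith
    · rw [if_neg ht']

lemma lintegral_norm_angle {k : ℕ} (ζ : UnitSphere (k + 2)) :
    ∃ C : ENNReal, ∀ h : ℝ × ℝ → ENNReal, Measurable h →
      ∫⁻ x : EuclideanSpace ℝ (Fin (k + 2)), h (‖x‖, InnerProductGeometry.angle (ζ : EuclideanSpace ℝ (Fin (k + 2))) x) =
        C * ∫⁻ r in Ioi (0 : ℝ), ∫⁻ t in Ioo 0 Real.pi,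
          ENNReal.ofReal (r ^ (k + 1)) * ENNReal.ofReal (Real.sin t ^ k) * h (r, t) := by
  set z : EuclideanSpace ℝ (Fin (k + 2)) := ζ.1
  have hz1 : ‖z‖ = 1 := norm_eq_of_mem_sphere ζ
  have h0 : z ≠ 0 := by intro h; simp [h] at hz1
  have hdim : Module.finrank ℝ (ℝ ∙ z)ᗮ = k + 1 := by
    have : Fact (Module.finrank ℝ (EuclideanSpace ℝ (Fin (k + 2))) = (k + 1) + 1) := ⟨by simp⟩
    exact Submodule.finrank_orthogonal_span_singleton h0
  have : Nontrivial (ℝ ∙ z)ᗮ := Module.nontrivial_of_finrank_pos (R := ℝ) (by omega)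
  refine ⟨(volume : Measure (ℝ ∙ z)ᗮ).toSphere univ, fun h hh => ?_⟩
  have hang : Measurable fun x : EuclideanSpace ℝ (Fin (k + 2)) =>
      InnerProductGeometry.angle z x := by
    unfold InnerProductGeometry.angle
    exact Real.measurable_arccos.comp (by fun_prop)
  have hmp := measurePreserving_smul_add_orthogonal hz1
  have hcomp := hh.comp (measurable_norm.prodMk hang)
  refine (hmp.lintegral_comp hcomp).symm.trans ?_
  rw [Measure.volume_eq_prod]
  refine (lintegral_prod _ (hcomp.comp hmp.measurable).aemeasurable).trans ?_
  have horth : ∀ y : (ℝ ∙ z)ᗮ, inner ℝ z (y : EuclideanSpace ℝ (Fin (k + 2))) = 0 :=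
    fun y => Submodule.mem_orthogonal_singleton_iff_inner_right.1 y.2
  have hnorm : ∀ (s : ℝ) (y : (ℝ ∙ z)ᗮ),
      ‖s • z + (y : EuclideanSpace ℝ (Fin (k + 2)))‖ = √(s ^ 2 + ‖y‖ ^ 2) := by
    intro s y
    rw [← Real.sqrt_sq (norm_nonneg (s • z + _)), norm_add_sq_real, real_inner_smul_left, horth,
      norm_smul, hz1]
    simp
  have hangle : ∀ (s : ℝ) (y : (ℝ ∙ z)ᗮ), InnerProductGeometry.angle z (s • z + (y : EuclideanSpace ℝ (Fin (k + 2)))) =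
      Real.arccos (s / √(s ^ 2 + ‖y‖ ^ 2)) := by
    intro s y
    rw [InnerProductGeometry.angle, hnorm, inner_add_right, horth, real_inner_smul_right,
      real_inner_self_eq_norm_sq, hz1]
    simp
  set H : ℝ × ℝ → ENNReal := fun p =>
    h (√(p.1 ^ 2 + p.2 ^ 2), Real.arccos (p.1 / √(p.1 ^ 2 + p.2 ^ 2)))
  have hH : Measurable H := by
    refine hh.comp (Measurable.prodMk (by fun_prop) (Real.measurable_arccos.comp (by fun_prop)))
  have hinner : ∀ s : ℝ, ∫⁻ y : (ℝ ∙ z)ᗮ, h (‖s • z + (y : EuclideanSpace ℝ (Fin (k + 2)))‖,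
      InnerProductGeometry.angle z (s • z + (y : EuclideanSpace ℝ (Fin (k + 2))))) = (volume : Measure (ℝ ∙ z)ᗮ).toSphere univ *
      ∫⁻ ρ in Ioi (0 : ℝ), ENNReal.ofReal (ρ ^ k) * H (s, ρ) := by
    intro s
    simp_rw [hangle, hnorm]
    have := lintegral_fun_norm_eq (volume : Measure (ℝ ∙ z)ᗮ) (f := fun ρ => H (s, ρ))
      (hH.comp (by fun_prop))
    rw [hdim, Nat.add_sub_cancel] at this
    exact this
  refine (lintegral_congr hinner).trans ?_
  have hm : Measurable fun p : ℝ × ℝ => ENNReal.ofReal (p.2 ^ k) * H p := by fun_prop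
  rw [lintegral_const_mul _ (Measurable.lintegral_prod_right' (ν := volume.restrict (Ioi 0)) hm)]
  congr 1
  refine (lintegral_upperHalfPlane_polar hm).trans ?_
  refine setLIntegral_congr_fun measurableSet_Ioi fun r hr => ?_
  refine setLIntegral_congr_fun measurableSet_Ioo fun t ht => ?_
  have hr' : 0 < r := hr
  have hsq : (r * Real.cos t) ^ 2 + (r * Real.sin t) ^ 2 = r ^ 2 := by
    rw [mul_pow, mul_pow, ← mul_add, Real.cos_sq_add_sin_sq, mul_one]
  have hs : 0 ≤ Real.sin t := (Real.sin_pos_of_mem_Ioo ht).le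
  simp only [H, hsq, Real.sqrt_sq hr'.le, mul_div_cancel_left₀ _ hr'.ne',
    Real.arccos_cos ht.1.le ht.2.le]
  rw [← mul_assoc, ← ENNReal.ofReal_mul hr'.le, ← ENNReal.ofReal_mul (by positivity)]
  congr 2
  rw [mul_pow]
  ring

lemma continuous_angle_sphere {n : ℕ} (ζ : UnitSphere n) :
    Continuous fun η : UnitSphere n =>
      InnerProductGeometry.angle (ζ : EuclideanSpace ℝ (Fin n)) η := by
  unfold InnerProductGeometry.angle
  refine Real.continuous_arccos.comp ?_
  simp only [norm_eq_of_mem_sphere, mul_one, div_one]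
  fun_prop

open scoped Pointwise in
/-- Under the polar angle from a fixed point, surface measure is proportional to
`sin ^ (n - 2) t dt` on `(0, π)`. -/
lemma map_angle_surfaceMeasure {k : ℕ} (ζ : UnitSphere (k + 2)) :
    ∃ C : ENNReal, (surfaceMeasure (k + 2)).map (fun η : UnitSphere (k + 2) =>
        InnerProductGeometry.angle (ζ : EuclideanSpace ℝ (Fin (k + 2))) η) =
      C • (volume.restrict (Ioo 0 Real.pi)).withDensity fun t => ENNReal.ofReal (Real.sin t ^ k) := by
  obtain ⟨C, hC⟩ := lintegral_norm_angle ζ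
  refine ⟨(k + 2 : ℕ) * (C * ∫⁻ r in Ioo (0 : ℝ) 1, ENNReal.ofReal (r ^ (k + 1))), ?_⟩
  ext T hT
  have hang := (continuous_angle_sphere ζ).measurable
  rw [Measure.map_apply hang hT, surfaceMeasure, Measure.toSphere_apply' _ (hang hT),
    Measure.smul_apply, withDensity_apply _ hT, smul_eq_mul, mul_assoc, finrank_euclideanSpace_fin]
  congr 1
  set h : ℝ × ℝ → ENNReal := (Ioo (0 : ℝ) 1 ×ˢ T).indicator 1
  have hh : Measurable h := measurable_one.indicator (measurableSet_Ioo.prod hT)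
  have hset : Ioo (0 : ℝ) 1 • (Subtype.val '' ((fun η : UnitSphere (k + 2) =>
      InnerProductGeometry.angle (ζ : EuclideanSpace ℝ (Fin (k + 2))) η) ⁻¹' T)) =
      {x : EuclideanSpace ℝ (Fin (k + 2)) | (‖x‖, InnerProductGeometry.angle (ζ : EuclideanSpace ℝ (Fin (k + 2))) x) ∈
        Ioo (0 : ℝ) 1 ×ˢ T} := by
    ext x
    simp only [Set.mem_smul, mem_image, mem_preimage, mem_ofPred_eq, mem_prod]
    constructor
    · rintro ⟨r, hr, _, ⟨η, hη, rfl⟩, rfl⟩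
      refine ⟨?_, ?_⟩
      · simpa [norm_smul, abs_of_pos hr.1] using hr
      · rwa [InnerProductGeometry.angle_smul_right_of_pos _ _ hr.1]
    · rintro ⟨hx, hxT⟩
      have hx0 : 0 < ‖x‖ := hx.1
      refine ⟨‖x‖, hx, ‖x‖⁻¹ • x, ⟨⟨‖x‖⁻¹ • x, ?_⟩, ?_, rfl⟩, ?_⟩
      · simp [norm_smul, hx0.ne']
      · simpa [InnerProductGeometry.angle_smul_right_of_pos _ _ (inv_pos.2 hx0)] using hxT
      · rw [smul_smul, mul_inv_cancel₀ hx0.ne', one_smul]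
  have hvol := hC h hh
  rw [hset]
  have hmeas : MeasurableSet {x : EuclideanSpace ℝ (Fin (k + 2)) |
      (‖x‖, InnerProductGeometry.angle (ζ : EuclideanSpace ℝ (Fin (k + 2))) x) ∈
        Ioo (0 : ℝ) 1 ×ˢ T} := by
    refine (measurableSet_Ioo.prod hT).preimage (measurable_norm.prodMk ?_)
    unfold InnerProductGeometry.angle
    exact Real.measurable_arccos.comp (by fun_prop)
  rw [← lintegral_indicator_one hmeas]
  refine hvol.trans ?_
  rw [mul_assoc]
  congr 1
  have hstep : ∀ r ∈ Ioi (0 : ℝ), ∫⁻ t in Ioo 0 Real.pi,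
      ENNReal.ofReal (r ^ (k + 1)) * ENNReal.ofReal (Real.sin t ^ k) * h (r, t) =
      (Iio (1 : ℝ)).indicator (fun r => ENNReal.ofReal (r ^ (k + 1))) r *
        ∫⁻ t in T, ENNReal.ofReal (Real.sin t ^ k) ∂volume.restrict (Ioo 0 Real.pi) := by
    intro r hr
    have hr' : 0 < r := hr
    rw [← lintegral_indicator hT, ← lintegral_const_mul _ (Measurable.indicator (by fun_prop) hT)]
    refine lintegral_congr fun t => ?_
    by_cases h1 : r < 1 <;> by_cases h2 : t ∈ T <;> simp [h, h1, h2, hr']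
  rw [setLIntegral_congr_fun measurableSet_Ioi hstep, lintegral_mul_const _
    (Measurable.indicator (by fun_prop) measurableSet_Iio), lintegral_indicator measurableSet_Iio,
    Measure.restrict_restrict measurableSet_Iio, Iio_inter_Ioi]

lemma integral_sin_pow_eq_Gamma (k : ℕ) : ∫ t in (0 : ℝ)..Real.pi, Real.sin t ^ k =
    √Real.pi * Real.Gamma (((k : ℝ) + 1) / 2) / Real.Gamma (((k : ℝ) + 2) / 2) := by
  induction k using Nat.twoStepInduction with
  | zero =>
    have : √Real.pi * √Real.pi = Real.pi := Real.mul_self_sqrt Real.pi_pos.le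
    have h : Real.Gamma 2⁻¹ = √Real.pi := by rw [← Real.Gamma_one_half_eq, one_div]
    simp [h, this]
  | one =>
    have h : Real.Gamma (3 / 2) = 1 / 2 * √Real.pi := by
      rw [← Real.Gamma_one_half_eq, ← Real.Gamma_add_one (by norm_num)]; norm_num
    have h0 : √Real.pi ≠ 0 := (Real.sqrt_pos.2 Real.pi_pos).ne'
    norm_num [h]
    field_simp
  | more k ih _ =>
    have h1 : Real.Gamma (((k : ℝ) + 2 + 1) / 2) =
        ((k : ℝ) + 1) / 2 * Real.Gamma (((k : ℝ) + 1) / 2) := by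
      rw [← Real.Gamma_add_one (by positivity)]; congr 1; ring
    have h2 : Real.Gamma (((k : ℝ) + 2 + 2) / 2) =
        ((k : ℝ) + 2) / 2 * Real.Gamma (((k : ℝ) + 2) / 2) := by
      rw [← Real.Gamma_add_one (by positivity)]; congr 1; ring
    have h3 : Real.Gamma (((k : ℝ) + 2) / 2) ≠ 0 := (Real.Gamma_pos_of_pos (by positivity)).ne'
    rw [integral_sin_pow, ih]
    push_cast
    rw [h1, h2]
    simp only [Real.sin_pi, Real.sin_zero, ne_eq, Nat.succ_ne_zero, not_false_eq_true, zero_pow,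
      zero_mul, sub_self, zero_div, zero_add]
    field_simp

instance isFiniteMeasure_surfaceMeasure (n : ℕ) : IsFiniteMeasure (surfaceMeasure n) := by
  unfold surfaceMeasure; infer_instance

lemma surfaceMeasure_real_univ_pos (k : ℕ) : 0 < (surfaceMeasure (k + 2)).real univ := by
  have h : surfaceMeasure (k + 2) ≠ 0 := by unfold surfaceMeasure; simp
  exact ENNReal.toReal_pos (by simpa using h) (measure_ne_top _ _)

/-- Integration over the sphere of functions of the polar angle. -/
lemma integral_comp_angle {k : ℕ} (ζ : UnitSphere (k + 2)) {h : ℝ → ℝ} (hh : Measurable h) :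
    ∫ η : UnitSphere (k + 2), h (InnerProductGeometry.angle (ζ : EuclideanSpace ℝ (Fin (k + 2))) η)
        ∂(surfaceMeasure (k + 2)) =
      (surfaceMeasure (k + 2)).real univ / (∫ t in (0 : ℝ)..Real.pi, Real.sin t ^ k) *
        ∫ t in (0 : ℝ)..Real.pi, Real.sin t ^ k * h t := by
  obtain ⟨C, hC⟩ := map_angle_surfaceMeasure ζ
  have hang := (continuous_angle_sphere ζ).measurable
  have key : ∀ g : ℝ → ℝ, Measurable g → ∫ η : UnitSphere (k + 2),
      g (InnerProductGeometry.angle (ζ : EuclideanSpace ℝ (Fin (k + 2))) η)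
        ∂(surfaceMeasure (k + 2)) = C.toReal * ∫ t in (0 : ℝ)..Real.pi, Real.sin t ^ k * g t := by
    intro g hg
    rw [← integral_map (φ := fun η : UnitSphere (k + 2) =>
      InnerProductGeometry.angle (ζ : EuclideanSpace ℝ (Fin (k + 2))) η) hang.aemeasurable
      hg.aestronglyMeasurable, hC, integral_smul_measure,
      integral_withDensity_eq_integral_toReal_smul (by fun_prop) (by simp),
      intervalIntegral.integral_of_le Real.pi_pos.le, integral_Ioc_eq_integral_Ioo, smul_eq_mul]
    congr 1
    refine setIntegral_congr_fun measurableSet_Ioo fun t ht => ?_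
    simp only [smul_eq_mul]
    rw [ENNReal.toReal_ofReal (pow_nonneg (Real.sin_pos_of_mem_Ioo ht).le _)]
  have h1 := key (fun _ => 1) measurable_const
  simp only [integral_const, smul_eq_mul, mul_one] at h1
  rw [key h hh, h1, mul_div_assoc, div_self (integral_sin_pow_pos k).ne', mul_one]

/-! ### Gauss's substitution and the total mass of the Poisson kernel -/

/-- The integral of the Poisson kernel over the sphere, in the polar angle. In the triangle formed
by the center, the point at distance `r` from it, and the point of the sphere at polar angle `t`,
let `s` be the exterior angle at the second vertex; the substitution `t = s - arcsin (r sin s)`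
turns the kernel into `1` plus a function that is odd under `s ↦ π - s`. -/
lemma integral_sin_pow_mul_poisson {r : ℝ} (hr0 : 0 ≤ r) (hr1 : r < 1) (k : ℕ) :
    ∫ t in (0 : ℝ)..Real.pi, Real.sin t ^ k *
        ((1 - r ^ 2) * (√(1 - 2 * r * Real.cos t + r ^ 2) ^ (k + 2))⁻¹) =
      ∫ t in (0 : ℝ)..Real.pi, Real.sin t ^ k := by
  have hs : ∀ s, r ^ 2 * Real.sin s ^ 2 < 1 := fun s => by
    nlinarith [Real.sin_sq_le_one s, sq_nonneg (Real.sin s)]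
  set q : ℝ → ℝ := fun s => √(1 - (r * Real.sin s) ^ 2) with hq
  have hqpos : ∀ s, 0 < q s := fun s => Real.sqrt_pos.2 (by nlinarith [hs s])
  have hqsq : ∀ s, q s ^ 2 = 1 - r ^ 2 * Real.sin s ^ 2 := fun s => by
    rw [hq]; simp only; rw [Real.sq_sqrt (by nlinarith [hs s])]; ring
  have hqc : Continuous q := by fun_prop
  have hlt : ∀ s, |r * Real.sin s| < 1 := fun s => by
    rw [← sq_lt_one_iff_abs_lt_one]; nlinarith [hs s]
  have hcosq : ∀ s, Real.cos (Real.arcsin (r * Real.sin s)) = q s := fun s => Real.cos_arcsin _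
  have hsinq : ∀ s, Real.sin (Real.arcsin (r * Real.sin s)) = r * Real.sin s := fun s =>
    Real.sin_arcsin (abs_lt.1 (hlt s)).1.le (abs_lt.1 (hlt s)).2.le
  -- The distance from the point at radius `r` to the point of the sphere is `q s - r cos s`.
  have hell : ∀ s, 0 < q s - r * Real.cos s := fun s => by
    have h1 : (r * Real.cos s) ^ 2 < q s ^ 2 := by
      rw [hqsq]; nlinarith [Real.sin_sq_add_cos_sq s]
    have := abs_lt_of_sq_lt_sq h1 (hqpos s).le
    linarith [(abs_lt.1 this).2]
  set T : ℝ → ℝ := fun s => s - Real.arcsin (r * Real.sin s)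
  have hT : ∀ s, HasDerivAt T (1 - r * Real.cos s / q s) s := fun s => by
    have h1 : HasDerivAt (fun s => r * Real.sin s) (r * Real.cos s) s :=
      (Real.hasDerivAt_sin s).const_mul r
    have h2 := (Real.hasDerivAt_arcsin (abs_lt.1 (hlt s)).1.ne' (abs_lt.1 (hlt s)).2.ne).comp s h1
    refine ((hasDerivAt_id s).sub h2).congr_deriv ?_
    simp only [hq]
    ring
  have hsinT : ∀ s, Real.sin (T s) = (q s - r * Real.cos s) * Real.sin s := fun s => by
    simp only [T]; rw [Real.sin_sub, hcosq, hsinq]; ring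
  have hcosT : ∀ s, Real.cos (T s) = Real.cos s * q s + r * Real.sin s ^ 2 := fun s => by
    simp only [T]; rw [Real.cos_sub, hcosq, hsinq]; ring
  have hdist : ∀ s, √(1 - 2 * r * Real.cos (T s) + r ^ 2) = q s - r * Real.cos s := fun s => by
    rw [hcosT, ← Real.sqrt_sq (hell s).le]
    congr 1
    have := hqsq s
    have := Real.sin_sq_add_cos_sq s
    nlinarith
  have hpos : ∀ t, 0 < 1 - 2 * r * Real.cos t + r ^ 2 := fun t => by
    nlinarith [Real.cos_le_one t]
  have hsub := intervalIntegral.integral_comp_mul_deriv (a := 0) (b := Real.pi) (f := T)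
    (f' := fun s => 1 - r * Real.cos s / q s)
    (g := fun t => Real.sin t ^ k * ((1 - r ^ 2) * (√(1 - 2 * r * Real.cos t + r ^ 2) ^ (k + 2))⁻¹))
    (fun s _ => hT s)
    (continuous_const.sub ((by fun_prop : Continuous fun s => r * Real.cos s).div hqc
      fun s => (hqpos s).ne')).continuousOn
    (by
      refine (by fun_prop : Continuous fun t => Real.sin t ^ k).mul (continuous_const.mul
        (Continuous.inv₀ (by fun_prop) fun t => ?_))
      exact pow_ne_zero _ (Real.sqrt_pos.2 (hpos t)).ne')
  have hT0 : T 0 = 0 := by simp [T]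
  have hTpi : T Real.pi = Real.pi := by simp [T]
  rw [hT0, hTpi] at hsub
  rw [← hsub]
  have hodd : ∫ s in (0 : ℝ)..Real.pi, r * Real.cos s / q s * Real.sin s ^ k = 0 := by
    have h1 := intervalIntegral.integral_comp_sub_left
      (fun s => r * Real.cos s / q s * Real.sin s ^ k) Real.pi (a := 0) (b := Real.pi)
    simp only [sub_self, sub_zero, hq, Real.sin_pi_sub, Real.cos_pi_sub, mul_neg, neg_div, neg_mul,
      intervalIntegral.integral_neg] at h1
    simp only [hq]
    linarith
  have hcont : Continuous fun s => r * Real.cos s / q s * Real.sin s ^ k :=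
    ((by fun_prop : Continuous fun s => r * Real.cos s).div hqc fun s => (hqpos s).ne').mul
      (by fun_prop)
  calc _ = ∫ s in (0 : ℝ)..Real.pi, (Real.sin s ^ k + r * Real.cos s / q s * Real.sin s ^ k) := by
        refine intervalIntegral.integral_congr fun s _ => ?_
        simp only [Function.comp_apply, hdist, hsinT]
        have h1 := (hell s).ne'
        have h2 := (hqpos s).ne'
        have h3 : 1 - r ^ 2 = (q s - r * Real.cos s) * (q s + r * Real.cos s) := by
          linear_combination -hqsq s + r ^ 2 * Real.sin_sq_add_cos_sq s
        rw [h3, mul_pow]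
        field_simp
        ring
    _ = _ := by
        rw [intervalIntegral.integral_add
          (Continuous.intervalIntegrable (by fun_prop) _ _) (hcont.intervalIntegrable _ _), hodd,
          add_zero]

lemma norm_smul_sub_sphere {n : ℕ} (r : ℝ) (ζ η : UnitSphere n) :
    ‖r • (ζ : EuclideanSpace ℝ (Fin n)) - η‖ = √(1 - 2 * r *
      Real.cos (InnerProductGeometry.angle (ζ : EuclideanSpace ℝ (Fin n)) η) + r ^ 2) := by
  have hζ : ‖(ζ : EuclideanSpace ℝ (Fin n))‖ = 1 := norm_eq_of_mem_sphere ζ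
  have hη : ‖(η : EuclideanSpace ℝ (Fin n))‖ = 1 := norm_eq_of_mem_sphere η
  rw [← Real.sqrt_sq (norm_nonneg (r • (ζ : EuclideanSpace ℝ (Fin n)) - η)), norm_sub_sq_real,
    InnerProductGeometry.cos_angle, real_inner_smul_left, norm_smul, hζ, hη]
  congr 1
  simp
  ring

lemma ballPoissonKernel_smul {n : ℕ} (r : ℝ) (ζ η : UnitSphere n) :
    ballPoissonKernel (r • (ζ : EuclideanSpace ℝ (Fin n))) η =
      (1 - r ^ 2) * (√(1 - 2 * r *
        Real.cos (InnerProductGeometry.angle (ζ : EuclideanSpace ℝ (Fin n)) η) + r ^ 2) ^ n)⁻¹ := by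
  rw [ballPoissonKernel, norm_smul_sub_sphere, norm_smul, norm_eq_of_mem_sphere]
  simp

lemma integral_ballPoissonKernel {k : ℕ} {x : EuclideanSpace ℝ (Fin (k + 2))} (hx : ‖x‖ < 1) :
    ∫ η : UnitSphere (k + 2), ballPoissonKernel x η ∂(surfaceMeasure (k + 2)) =
      (surfaceMeasure (k + 2)).real univ := by
  rcases eq_or_ne x 0 with rfl | h0
  · simp [ballPoissonKernel]
  set ζ : UnitSphere (k + 2) := ⟨‖x‖⁻¹ • x, by simp [norm_smul, h0]⟩ with hζ
  have hxζ : x = ‖x‖ • (ζ : EuclideanSpace ℝ (Fin (k + 2))) := by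
    simp [hζ, smul_smul, h0]
  have h1 : ∀ η : UnitSphere (k + 2), ballPoissonKernel x η = _ := fun η =>
    (congrArg (fun y => ballPoissonKernel y (η : EuclideanSpace ℝ (Fin (k + 2)))) hxζ).trans
      (ballPoissonKernel_smul ‖x‖ ζ η)
  rw [integral_congr_ae (.of_forall h1), integral_comp_angle ζ
    (h := fun t => (1 - ‖x‖ ^ 2) * (√(1 - 2 * ‖x‖ * Real.cos t + ‖x‖ ^ 2) ^ (k + 2))⁻¹)
    (by fun_prop), integral_sin_pow_mul_poisson (norm_nonneg x) hx,
    div_mul_cancel₀ _ (integral_sin_pow_pos k).ne']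

/-! ### The Poisson integral formula -/

section Poisson

variable {k : ℕ}

lemma ballPoissonKernel_nonneg {n : ℕ} {x : EuclideanSpace ℝ (Fin n)} (hx : ‖x‖ < 1)
    (y : EuclideanSpace ℝ (Fin n)) : 0 ≤ ballPoissonKernel x y := by
  have : 0 ≤ 1 - ‖x‖ ^ 2 := by nlinarith [norm_nonneg x]
  unfold ballPoissonKernel
  positivity

lemma continuous_ballPoissonKernel_sphere {n : ℕ} {x : EuclideanSpace ℝ (Fin n)} (hx : ‖x‖ < 1) :
    Continuous fun η : UnitSphere n => ballPoissonKernel x η := by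
  unfold ballPoissonKernel
  refine continuous_const.mul (Continuous.inv₀ (by fun_prop) fun η => pow_ne_zero _ ?_)
  rw [norm_ne_zero_iff, sub_ne_zero]
  rintro rfl
  simp [norm_eq_of_mem_sphere] at hx

lemma integrable_of_continuous_sphere {n : ℕ} {g : UnitSphere n → ℝ} (hg : Continuous g) :
    Integrable g (surfaceMeasure n) :=
  hg.integrable_of_hasCompactSupport (HasCompactSupport.of_compactSpace g)

lemma InnerProductSpace.HarmonicOnNhd.continuous_sphere {n : ℕ} {u : EuclideanSpace ℝ (Fin n) → ℝ}
    (hu : HarmonicOnNhd u (Metric.closedBall 0 1)) : Continuous fun η : UnitSphere n => u η :=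
  hu.continuousOn.comp_continuous continuous_subtype_val fun η =>
    Metric.sphere_subset_closedBall η.2

/-- Near the sphere a function that is continuous up to the boundary is close to the Poisson integral
of its boundary values, uniformly in the direction: the kernel has total mass one and tends to zero
away from its pole. -/
lemma eventually_sub_poissonIntegral_le {u : EuclideanSpace ℝ (Fin (k + 2)) → ℝ}
    (hu : HarmonicOnNhd u (Metric.closedBall 0 1)) {ε : ℝ} (hε : 0 < ε) :
    ∀ᶠ ρ in 𝓝[<] (1 : ℝ), ∀ z : EuclideanSpace ℝ (Fin (k + 2)), ‖z‖ = ρ →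
      u z - ((surfaceMeasure (k + 2)).real univ)⁻¹ *
        ∫ η : UnitSphere (k + 2), u η * ballPoissonKernel z η ∂(surfaceMeasure (k + 2)) ≤ ε := by
  set M := (surfaceMeasure (k + 2)).real univ
  have hM : 0 < M := surfaceMeasure_real_univ_pos k
  have hK := isCompact_closedBall (0 : EuclideanSpace ℝ (Fin (k + 2))) 1
  obtain ⟨B, hB⟩ := hK.exists_bound_of_continuousOn hu.continuousOn
  obtain ⟨δ, hδ, huc⟩ := Metric.uniformContinuousOn_iff.1
    (hK.uniformContinuousOn_of_continuous hu.continuousOn) (ε / 2) (by positivity)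
  have hsmall : Tendsto (fun ρ : ℝ => 2 * B * ((1 - ρ ^ 2) * (δ ^ (k + 2))⁻¹)) (𝓝[<] 1) (𝓝 0) := by
    have : Continuous fun ρ : ℝ => 2 * B * ((1 - ρ ^ 2) * (δ ^ (k + 2))⁻¹) := by fun_prop
    have h := this.tendsto 1
    simp only [one_pow, sub_self, zero_mul, mul_zero] at h
    exact h.mono_left nhdsWithin_le_nhds
  filter_upwards [hsmall.eventually (ge_mem_nhds (show (0 : ℝ) < ε / 2 by positivity)),
    self_mem_nhdsWithin] with ρ hρ hρ1 z hz
  have hρ1' : ρ < 1 := hρ1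
  have hz1 : ‖z‖ < 1 := hz ▸ hρ1'
  have hB0 : 0 ≤ B := (norm_nonneg _).trans (hB 0 (by simp))
  have hzb : z ∈ Metric.closedBall (0 : EuclideanSpace ℝ (Fin (k + 2))) 1 := by simpa using hz1.le
  have hPc := continuous_ballPoissonKernel_sphere hz1
  have hP := integrable_of_continuous_sphere hPc
  have huP : Integrable (fun η : UnitSphere (k + 2) => u η * ballPoissonKernel z η)
      (surfaceMeasure (k + 2)) :=
    integrable_of_continuous_sphere (hu.continuous_sphere.mul hPc)
  have hpt : ∀ η : UnitSphere (k + 2), u z * ballPoissonKernel z η - u η * ballPoissonKernel z η ≤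
      ε / 2 * ballPoissonKernel z η + ε / 2 := by
    intro η
    have hηb : (η : EuclideanSpace ℝ (Fin (k + 2))) ∈
        Metric.closedBall (0 : EuclideanSpace ℝ (Fin (k + 2))) 1 :=
      Metric.sphere_subset_closedBall η.2
    have hP0 := ballPoissonKernel_nonneg hz1 (η : EuclideanSpace ℝ (Fin (k + 2)))
    rw [← sub_mul]
    rcases lt_or_ge (dist z (η : EuclideanSpace ℝ (Fin (k + 2)))) δ with h | h
    · have h1 := (abs_lt.1 (Real.dist_eq _ _ ▸ huc z hzb η hηb h)).2
      nlinarith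
    · have h1 := abs_le.1 (Real.norm_eq_abs _ ▸ hB z hzb)
      have h2 := abs_le.1 (Real.norm_eq_abs _ ▸ hB η hηb)
      have h3 : ballPoissonKernel z (η : EuclideanSpace ℝ (Fin (k + 2))) ≤
          (1 - ρ ^ 2) * (δ ^ (k + 2))⁻¹ := by
        rw [ballPoissonKernel, hz]
        have : 0 ≤ 1 - ρ ^ 2 := by rw [← hz]; nlinarith [norm_nonneg z]
        rw [dist_eq_norm] at h
        gcongr
      have h4 : (u z - u η) * ballPoissonKernel z η ≤ 2 * B * ((1 - ρ ^ 2) * (δ ^ (k + 2))⁻¹) := by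
        calc _ ≤ 2 * B * ballPoissonKernel z (η : EuclideanSpace ℝ (Fin (k + 2))) := by
              gcongr; linarith
          _ ≤ _ := by gcongr
      have h5 : 0 ≤ ε / 2 * ballPoissonKernel z (η : EuclideanSpace ℝ (Fin (k + 2))) := by positivity
      linarith
  have hint := integral_mono ((hP.const_mul (u z)).sub huP)
    ((hP.const_mul (ε / 2)).add (integrable_const (ε / 2))) hpt
  simp only [Pi.add_apply, Pi.sub_apply] at hint
  rw [integral_sub (hP.const_mul (u z)) huP, integral_const_mul, integral_ballPoissonKernel hz1,
    integral_add (hP.const_mul _) (integrable_const _), integral_const_mul,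
    integral_ballPoissonKernel hz1, integral_const, smul_eq_mul] at hint
  change u z * M - _ ≤ ε / 2 * M + M * (ε / 2) at hint
  refine le_of_mul_le_mul_left ?_ hM
  rw [mul_sub, mul_inv_cancel_left₀ hM.ne']
  linarith

/-- One half of the Poisson formula: the maximum principle for the difference of the two sides. -/
lemma InnerProductSpace.HarmonicOnNhd.le_poissonIntegral {u : EuclideanSpace ℝ (Fin (k + 2)) → ℝ}
    (hu : HarmonicOnNhd u (Metric.closedBall 0 1)) {x : EuclideanSpace ℝ (Fin (k + 2))}
    (hx : ‖x‖ < 1) : u x ≤ ((surfaceMeasure (k + 2)).real univ)⁻¹ *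
      ∫ η : UnitSphere (k + 2), u η * ballPoissonKernel x η ∂(surfaceMeasure (k + 2)) := by
  refine le_of_forall_pos_le_add fun ε hε => ?_
  have hlt : ∀ᶠ ρ in 𝓝[<] (1 : ℝ), ‖x‖ < ρ :=
    nhdsWithin_le_nhds (lt_mem_nhds hx)
  obtain ⟨ρ, ⟨hρ, hxρ⟩, hρ1⟩ := ((eventually_sub_poissonIntegral_le hu hε).and hlt).and
    self_mem_nhdsWithin |>.exists
  have hρ1' : ρ < 1 := hρ1
  have hv := (harmonicOnNhd_poissonIntegral
    (integrable_of_continuous_sphere hu.continuous_sphere)).mono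
    (ball_subset_awayFrom (surfaceMeasure (k + 2)))
  have hv' := hv.const_smul (c := ((surfaceMeasure (k + 2)).real univ)⁻¹)
  have hw := (hu.mono (Metric.closedBall_subset_closedBall hρ1'.le)).sub
    (hv'.mono (Metric.closedBall_subset_ball hρ1'))
  have := hw.le_of_le_sphere (by omega) (ε := ε) (fun z hz => by simpa using hρ z hz) hxρ.le
  simp only [Pi.sub_apply, Pi.smul_apply, smul_eq_mul] at this
  linarith

/-- The Poisson integral formula for functions that are harmonic near the closed unit ball. -/
theorem InnerProductSpace.HarmonicOnNhd.eq_poissonIntegral {u : EuclideanSpace ℝ (Fin (k + 2)) → ℝ}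
    (hu : HarmonicOnNhd u (Metric.closedBall 0 1)) {x : EuclideanSpace ℝ (Fin (k + 2))}
    (hx : ‖x‖ < 1) : u x = ((surfaceMeasure (k + 2)).real univ)⁻¹ *
      ∫ η : UnitSphere (k + 2), u η * ballPoissonKernel x η ∂(surfaceMeasure (k + 2)) := by
  refine le_antisymm (hu.le_poissonIntegral hx) ?_
  have h := hu.neg.le_poissonIntegral hx
  simp only [Pi.neg_apply, neg_mul, integral_neg, mul_neg] at h
  linarith

end Poisson

lemma InnerProductSpace.HarmonicAt.comp_smul {n : ℕ} {u : EuclideanSpace ℝ (Fin n) → ℝ} {c : ℝ}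
    {x : EuclideanSpace ℝ (Fin n)} (hu : HarmonicAt u (c • x)) :
    HarmonicAt (fun x => u (c • x)) x := by
  have hc : Continuous fun x : EuclideanSpace ℝ (Fin n) => c • x := by fun_prop
  refine ⟨hu.1.comp x (by fun_prop), ?_⟩
  filter_upwards [hc.continuousAt.eventually hu.2] with y hy
  have h1 : fderiv ℝ (fun x => u (c • x)) = fun x => c • fderiv ℝ u (c • x) := by
    ext1 x; exact fderiv_comp_smul (f := u) ..
  have h2 : fderiv ℝ (fun x => c • fderiv ℝ u (c • x)) y = c • c • fderiv ℝ (fderiv ℝ u) (c • y) := by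
    exact (congrFun (fderiv_const_smul_field (𝕜 := ℝ) (f := fun x => fderiv ℝ u (c • x)) c) y).trans
      (congrArg (c • ·) (fderiv_comp_smul (𝕜 := ℝ) (f := fderiv ℝ u) (x := y) c))
  rw [laplacian_apply_eq_sum] at hy ⊢
  rw [h1, h2]
  simp only [smul_apply, ← Finset.smul_sum, hy, Pi.zero_apply, smul_zero]

/-! ### Polar caps -/

section Caps

variable {k : ℕ}

lemma isClosed_polarCap {n : ℕ} (ζ : UnitSphere n) (α : ℝ) : IsClosed (polarCap ζ α) :=
  isClosed_le (continuous_angle_sphere ζ) continuous_const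

lemma integral_sin_pow_pos_of_lt {a b : ℝ} (ha : 0 ≤ a) (hab : a < b) (hb : b ≤ Real.pi) (k : ℕ) :
    0 < ∫ t in a..b, Real.sin t ^ k :=
  intervalIntegral.intervalIntegral_pos_of_pos_on (Continuous.intervalIntegrable (by fun_prop) _ _)
    (fun _ ht => pow_pos (Real.sin_pos_of_pos_of_lt_pi (ha.trans_lt ht.1) (ht.2.trans_le hb)) _) hab

lemma integral_compl_polarCap {α : ℝ} (hα0 : 0 ≤ α) (hα : α ≤ Real.pi) (ζ : UnitSphere (k + 2))
    {h : ℝ → ℝ} (hh : Measurable h) :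
    ∫ η in (polarCap ζ α)ᶜ, h (InnerProductGeometry.angle (ζ : EuclideanSpace ℝ (Fin (k + 2))) η)
        ∂(surfaceMeasure (k + 2)) =
      (surfaceMeasure (k + 2)).real univ / (∫ t in (0 : ℝ)..Real.pi, Real.sin t ^ k) *
        ∫ t in α..Real.pi, Real.sin t ^ k * h t := by
  rw [← integral_indicator (isClosed_polarCap ζ α).measurableSet.compl]
  have h1 := integral_comp_angle ζ (hh.indicator (measurableSet_Ioi (a := α)))
  have h2 : ∫ t in (0 : ℝ)..Real.pi, Real.sin t ^ k * (Ioi α).indicator h t =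
      ∫ t in α..Real.pi, Real.sin t ^ k * h t := by
    rw [intervalIntegral.integral_of_le (hα0.trans hα), intervalIntegral.integral_of_le hα]
    have h3 : (fun t => Real.sin t ^ k * (Ioi α).indicator h t) =
        (Ioi α).indicator fun t => Real.sin t ^ k * h t := by
      ext t; by_cases ht : t ∈ Ioi α <;> simp [ht]
    rw [h3, setIntegral_indicator measurableSet_Ioi, Ioc_inter_Ioi, sup_eq_right.2 hα0]
  rw [← h2, ← h1]
  refine integral_congr_ae (.of_forall fun η => ?_)
  by_cases hη : InnerProductGeometry.angle (ζ : EuclideanSpace ℝ (Fin (k + 2))) η ≤ α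
  · have : η ∈ polarCap ζ α := hη
    simp [this, hη]
  · have : η ∉ polarCap ζ α := hη
    simp [this, not_le.1 hη]

lemma surfaceMeasure_real_polarCap {α : ℝ} (hα0 : 0 ≤ α) (hα : α ≤ Real.pi)
    (ζ : UnitSphere (k + 2)) : (surfaceMeasure (k + 2)).real (polarCap ζ α) =
      (surfaceMeasure (k + 2)).real univ / (∫ t in (0 : ℝ)..Real.pi, Real.sin t ^ k) *
        ∫ t in (0 : ℝ)..α, Real.sin t ^ k := by
  have h1 := integral_compl_polarCap hα0 hα ζ (h := fun _ => 1) measurable_const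
  have h2 := measureReal_add_measureReal_compl (μ := surfaceMeasure (k + 2))
    (isClosed_polarCap ζ α).measurableSet
  simp only [integral_const, smul_eq_mul, mul_one, measureReal_restrict_apply_univ] at h1
  have h3 := intervalIntegral.integral_add_adjacent_intervals (μ := volume) (a := 0) (b := α)
    (c := Real.pi) (f := fun t => Real.sin t ^ k) (Continuous.intervalIntegrable (by fun_prop) _ _)
    (Continuous.intervalIntegrable (by fun_prop) _ _)
  have hI := (integral_sin_pow_pos k).ne'
  rw [h1] at h2
  field_simp at h2 ⊢
  rw [← h3] at h2 ⊢
  linear_combination h2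

/-- The measure of a cap is a strictly increasing continuous function of its angle, so the set that
defines `capAngle` is a singleton. -/
lemma capAngle_spec {c : ℝ} (hc0 : 0 < c) (hc1 : c < 1) :
    capAngle (k + 2) c ∈ Ioo 0 Real.pi ∧ ∀ ζ : UnitSphere (k + 2),
      (surfaceMeasure (k + 2)).real (polarCap ζ (capAngle (k + 2) c)) =
        c * (surfaceMeasure (k + 2)).real univ := by
  set I := ∫ t in (0 : ℝ)..Real.pi, Real.sin t ^ k with hI
  have hIpos : 0 < I := integral_sin_pow_pos k
  have hM := surfaceMeasure_real_univ_pos k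
  set J : ℝ → ℝ := fun α => ∫ t in (0 : ℝ)..α, Real.sin t ^ k
  have hii : ∀ a b : ℝ, IntervalIntegrable (fun t => Real.sin t ^ k) volume a b :=
    fun a b => Continuous.intervalIntegrable (by fun_prop) a b
  have hJc : Continuous J := intervalIntegral.continuous_primitive hii 0
  have hJmono : StrictMonoOn J (Icc 0 Real.pi) := fun x hx y hy hxy => by
    have h1 := intervalIntegral.integral_add_adjacent_intervals (hii 0 x) (hii x y)
    have h2 := integral_sin_pow_pos_of_lt hx.1 hxy hy.2 k
    simp only [J]
    linarith
  have hJ0 : J 0 = 0 := by simp [J]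
  obtain ⟨α, hα, hαJ⟩ : c * I ∈ J '' Ioo 0 Real.pi := by
    refine intermediate_value_Ioo Real.pi_pos.le hJc.continuousOn ⟨?_, ?_⟩
    · rw [hJ0]; positivity
    · change c * I < I; nlinarith
  have hiff : ∀ β ∈ Icc 0 Real.pi, ∀ ζ : UnitSphere (k + 2),
      ((surfaceMeasure (k + 2)).real (polarCap ζ β) = c * (surfaceMeasure (k + 2)).real univ ↔
        β = α) := by
    intro β hβ ζ
    rw [surfaceMeasure_real_polarCap hβ.1 hβ.2, ← hJmono.injOn.eq_iff hβ (Ioo_subset_Icc_self hα),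
      hαJ, ← hI, div_mul_eq_mul_div, div_eq_iff hIpos.ne']
    constructor
    · intro h
      refine mul_left_cancel₀ hM.ne' ?_
      simp only [J]
      linear_combination h
    · intro h
      change _ * J β = _
      rw [h]; ring
  have hset : {α : ℝ | α ∈ Icc 0 Real.pi ∧ ∀ ζ : UnitSphere (k + 2),
      (surfaceMeasure (k + 2)).real (polarCap ζ α) = c * (surfaceMeasure (k + 2)).real univ} =
      {α} := by
    ext β
    constructor
    · rintro ⟨hβ, h⟩
      exact (hiff β hβ ⟨EuclideanSpace.single 0 1, by simp⟩).1 (h _)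
    · rintro rfl
      exact ⟨Ioo_subset_Icc_self hα, fun ζ => (hiff _ (Ioo_subset_Icc_self hα) ζ).2 rfl⟩
  have hcap : capAngle (k + 2) c = α := by
    rw [capAngle, hset, csSup_singleton]
  rw [hcap]
  exact ⟨hα, fun ζ => (hiff _ (Ioo_subset_Icc_self hα) ζ).2 rfl⟩

end Caps

/-! ### The extremal harmonic function -/

section Extremal

variable {k : ℕ}

/-- The Poisson integral of the function that is `1` on the polar cap of center `ζ` and angle `α`
and `-1` elsewhere on the sphere. It is written as `1` minus an integral over the complement of the
cap, which makes sense also outside the ball and is harmonic near the interior of the cap. -/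
noncomputable def capPoisson (ζ : UnitSphere (k + 2)) (α : ℝ) (x : EuclideanSpace ℝ (Fin (k + 2))) :
    ℝ :=
  1 - 2 / (surfaceMeasure (k + 2)).real univ *
    ∫ η in (polarCap ζ α)ᶜ, ballPoissonKernel x η ∂(surfaceMeasure (k + 2))

lemma harmonicOnNhd_capPoisson (ζ : UnitSphere (k + 2)) (α : ℝ) :
    HarmonicOnNhd (capPoisson ζ α) (awayFrom ((surfaceMeasure (k + 2)).restrict (polarCap ζ α)ᶜ)) := by
  have h := (harmonicOnNhd_const (E := EuclideanSpace ℝ (Fin (k + 2)))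
    (s := awayFrom ((surfaceMeasure (k + 2)).restrict (polarCap ζ α)ᶜ)) (1 : ℝ)).sub
    ((harmonicOnNhd_poissonIntegral (ν := (surfaceMeasure (k + 2)).restrict (polarCap ζ α)ᶜ)
      (g := fun _ => 1) (integrable_const _)).const_smul
      (c := 2 / (surfaceMeasure (k + 2)).real univ))
  simp only [one_smul] at h
  exact h

lemma dist_center_sphere {n : ℕ} (ζ η : UnitSphere n) :
    dist (ζ : EuclideanSpace ℝ (Fin n)) η =
      2 * Real.sin (InnerProductGeometry.angle (ζ : EuclideanSpace ℝ (Fin n)) η / 2) := by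
  set t := InnerProductGeometry.angle (ζ : EuclideanSpace ℝ (Fin n)) η
  have h := norm_smul_sub_sphere 1 ζ η
  have h0 : 0 ≤ Real.sin (t / 2) := Real.sin_nonneg_of_nonneg_of_le_pi
    (by linarith [InnerProductGeometry.angle_nonneg (ζ : EuclideanSpace ℝ (Fin n)) η])
    (by linarith [InnerProductGeometry.angle_le_pi (ζ : EuclideanSpace ℝ (Fin n)) η, Real.pi_pos])
  rw [one_smul] at h
  rw [dist_eq_norm, h, ← Real.sqrt_sq (show 0 ≤ 2 * Real.sin (t / 2) by positivity)]
  congr 1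
  have h1 : Real.cos t = 1 - 2 * Real.sin (t / 2) ^ 2 := by
    have := Real.cos_two_mul (t / 2)
    rw [mul_div_cancel₀ _ two_ne_zero] at this
    nlinarith [Real.sin_sq_add_cos_sq (t / 2)]
  change 1 - 2 * 1 * Real.cos t + 1 ^ 2 = _
  rw [h1]; ring

/-- The complement of the cap stays away from the center, so `capPoisson` is smooth there. -/
lemma center_mem_awayFrom {α : ℝ} (hα0 : 0 < α) (hα : α < Real.pi) (ζ : UnitSphere (k + 2)) :
    (ζ : EuclideanSpace ℝ (Fin (k + 2))) ∈
      awayFrom ((surfaceMeasure (k + 2)).restrict (polarCap ζ α)ᶜ) := by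
  refine ⟨2 * Real.sin (α / 2), ?_, ?_⟩
  · have := Real.sin_pos_of_pos_of_lt_pi (x := α / 2) (by linarith) (by linarith)
    positivity
  · filter_upwards [ae_restrict_mem (isClosed_polarCap ζ α).measurableSet.compl] with η hη
    have hη' : α < InnerProductGeometry.angle (ζ : EuclideanSpace ℝ (Fin (k + 2))) η := not_le.1 hη
    have := InnerProductGeometry.angle_le_pi (ζ : EuclideanSpace ℝ (Fin (k + 2))) η
    rw [dist_center_sphere]
    have := Real.sin_le_sin_of_le_of_le_pi_div_two (x := α / 2)
      (y := InnerProductGeometry.angle (ζ : EuclideanSpace ℝ (Fin (k + 2))) η / 2) (by linarith)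
      (by linarith) (by linarith)
    linarith

lemma ballPoissonKernel_of_norm_eq_one {n : ℕ} {x : EuclideanSpace ℝ (Fin n)} (hx : ‖x‖ = 1)
    (y : EuclideanSpace ℝ (Fin n)) : ballPoissonKernel x y = 0 := by
  simp [ballPoissonKernel, hx]

lemma capPoisson_center (ζ : UnitSphere (k + 2)) (α : ℝ) : capPoisson ζ α ζ = 1 := by
  simp [capPoisson, ballPoissonKernel_of_norm_eq_one (norm_eq_of_mem_sphere ζ)]

lemma partialFst_ballPoissonKernel_sphere {n : ℕ} {ζ η : UnitSphere n}
    (h : (ζ : EuclideanSpace ℝ (Fin n)) ≠ η) :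
    partialFst (fun p : EuclideanSpace ℝ (Fin n) × EuclideanSpace ℝ (Fin n) =>
      ballPoissonKernel p.1 p.2) (ζ, η) =
      (-2 * (dist (ζ : EuclideanSpace ℝ (Fin n)) η ^ n)⁻¹) • innerSL ℝ (ζ : EuclideanSpace ℝ (Fin n)) := by
  have h1 := hasFDerivAt_partialFst (k := 1) one_ne_zero contDiffOn_ballPoissonKernel h
  have h0 : (ζ : EuclideanSpace ℝ (Fin n)) - η ≠ 0 := sub_ne_zero.2 h
  have hK : DifferentiableAt ℝ (fun x : EuclideanSpace ℝ (Fin n) => (‖x - η‖ ^ n)⁻¹) ζ := by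
    have : DifferentiableAt ℝ (fun x : EuclideanSpace ℝ (Fin n) => ‖x - η‖) ζ :=
      (differentiableAt_id.sub_const _).norm ℝ h0
    exact (this.pow n).inv (pow_ne_zero _ (norm_ne_zero_iff.2 h0))
  have hA : HasFDerivAt (fun x : EuclideanSpace ℝ (Fin n) => 1 - ‖x‖ ^ 2)
      (-(2 • innerSL ℝ (ζ : EuclideanSpace ℝ (Fin n)))) ζ :=
    (hasStrictFDerivAt_norm_sq (ζ : EuclideanSpace ℝ (Fin n))).hasFDerivAt.const_sub 1
  have h2 := hA.mul hK.hasFDerivAt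
  refine (h1.unique h2).trans ?_
  rw [norm_eq_of_mem_sphere, dist_eq_norm]
  ext v
  simp
  ring

lemma hasFDerivAt_capPoisson_center {α : ℝ} (hα0 : 0 < α) (hα : α < Real.pi)
    (ζ : UnitSphere (k + 2)) :
    HasFDerivAt (capPoisson ζ α) ((2 ^ (-(k : ℤ)) / (∫ t in (0 : ℝ)..Real.pi, Real.sin t ^ k) *
      ∫ t in α..Real.pi, Real.sin t ^ k / Real.sin (t / 2) ^ (k + 2)) •
        innerSL ℝ (ζ : EuclideanSpace ℝ (Fin (k + 2)))) ζ := by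
  set M := (surfaceMeasure (k + 2)).real univ with hMdef
  have hM : 0 < M := surfaceMeasure_real_univ_pos k
  have hI := (integral_sin_pow_pos k).ne'
  have hmem := center_mem_awayFrom hα0 hα ζ
  have h := (hasFDerivAt_integral_kernel (g := fun _ => 1) (integrable_const (1 : ℝ))
    contDiffOn_ballPoissonKernel hmem).const_smul (2 / M) |>.const_sub 1
  simp only [one_smul] at h
  refine h.congr_fderiv ?_
  have hint : ∫ η : UnitSphere (k + 2), partialFst
      (fun p : EuclideanSpace ℝ (Fin (k + 2)) × EuclideanSpace ℝ (Fin (k + 2)) =>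
        ballPoissonKernel p.1 p.2) (ζ, η) ∂(surfaceMeasure (k + 2)).restrict (polarCap ζ α)ᶜ =
      (∫ η in (polarCap ζ α)ᶜ, -2 * ((2 * Real.sin (InnerProductGeometry.angle
        (ζ : EuclideanSpace ℝ (Fin (k + 2))) η / 2)) ^ (k + 2))⁻¹ ∂(surfaceMeasure (k + 2))) •
      innerSL ℝ (ζ : EuclideanSpace ℝ (Fin (k + 2))) := by
    refine Eq.trans ?_ (integral_smul_const (fun η : UnitSphere (k + 2) =>
      -2 * ((2 * Real.sin (InnerProductGeometry.angle (ζ : EuclideanSpace ℝ (Fin (k + 2))) η / 2)) ^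
        (k + 2))⁻¹) (innerSL ℝ (ζ : EuclideanSpace ℝ (Fin (k + 2)))))
    obtain ⟨δ, hδ, hae⟩ := hmem
    refine integral_congr_ae ?_
    filter_upwards [hae] with η hη
    have hne : (ζ : EuclideanSpace ℝ (Fin (k + 2))) ≠ η := fun heq => by
      rw [← heq, dist_self] at hη
      linarith
    rw [partialFst_ballPoissonKernel_sphere hne, dist_center_sphere]
  rw [hint, integral_compl_polarCap hα0.le hα.le ζ
    (h := fun t => -2 * ((2 * Real.sin (t / 2)) ^ (k + 2))⁻¹) (by fun_prop), ← hMdef]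
  have h4 : ∫ t in α..Real.pi, Real.sin t ^ k * (-2 * ((2 * Real.sin (t / 2)) ^ (k + 2))⁻¹) =
      (-2 * (2 ^ (k + 2))⁻¹) *
        ∫ t in α..Real.pi, Real.sin t ^ k / Real.sin (t / 2) ^ (k + 2) := by
    rw [← intervalIntegral.integral_const_mul]
    refine intervalIntegral.integral_congr fun t _ => ?_
    simp only [mul_pow, mul_inv]
    ring
  rw [h4, smul_smul, ← neg_smul]
  congr 1
  rw [zpow_neg, zpow_natCast]
  field_simp
  ring

/-- The Gamma factors in `schwarzConst` normalize the density `sin ^ k` of the polar angle. -/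
lemma schwarzConst_eq (k : ℕ) (a : ℝ) : schwarzConst (k + 2) a =
    2 ^ (-(k : ℤ)) / (∫ t in (0 : ℝ)..Real.pi, Real.sin t ^ k) *
      ∫ t in (capAngle (k + 2) ((a + 1) / 2))..Real.pi,
        Real.sin t ^ k / Real.sin (t / 2) ^ (k + 2) := by
  rw [schwarzConst, integral_sin_pow_eq_Gamma, Nat.add_sub_cancel]
  have h1 : (2 - ((k + 2 : ℕ) : ℤ)) = -(k : ℤ) := by push_cast; ring
  have h2 : (((k + 2 : ℕ) : ℝ) - 1) / 2 = ((k : ℝ) + 1) / 2 := by push_cast; ring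
  rw [h1, h2]
  push_cast
  congr 1
  have h3 : Real.Gamma (((k : ℝ) + 2) / 2) ≠ 0 := (Real.Gamma_pos_of_pos (by positivity)).ne'
  have h4 : Real.Gamma (((k : ℝ) + 1) / 2) ≠ 0 := (Real.Gamma_pos_of_pos (by positivity)).ne'
  have h5 : √Real.pi ≠ 0 := (Real.sqrt_pos.2 Real.pi_pos).ne'
  field_simp

lemma schwarzConst_pos {a : ℝ} (ha0 : -1 < a) (ha1 : a < 1) : 0 < schwarzConst (k + 2) a := by
  obtain ⟨hα, -⟩ := capAngle_spec (k := k) (c := (a + 1) / 2) (by linarith) (by linarith)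
  rw [schwarzConst_eq]
  have hI := integral_sin_pow_pos k
  refine mul_pos (by positivity) ?_
  have hs : ∀ t ∈ Icc (capAngle (k + 2) ((a + 1) / 2)) Real.pi, 0 < Real.sin (t / 2) :=
    fun t ht => Real.sin_pos_of_pos_of_lt_pi (by linarith [hα.1, ht.1]) (by linarith [hα.1, ht.1, ht.2])
  refine intervalIntegral.intervalIntegral_pos_of_pos_on ?_ ?_ hα.2
  · refine ContinuousOn.intervalIntegrable ?_
    rw [uIcc_of_le hα.2.le]
    exact ContinuousOn.div (by fun_prop) (by fun_prop) fun t ht => (pow_pos (hs t ht) _).ne'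
  · exact fun t ht => div_pos (pow_pos (Real.sin_pos_of_pos_of_lt_pi (hα.1.trans ht.1) ht.2) _)
      (pow_pos (hs t (Ioo_subset_Icc_self ht)) _)

end Extremal

/-! ### The harmonic Schwarz lemma on a radius -/

section Schwarz

variable {k : ℕ}

lemma setIntegral_ballPoissonKernel_pos {x : EuclideanSpace ℝ (Fin (k + 2))} (hx : ‖x‖ < 1)
    {A : Set (UnitSphere (k + 2))} (hA : 0 < (surfaceMeasure (k + 2)).real A) :
    0 < ∫ η in A, ballPoissonKernel x η ∂(surfaceMeasure (k + 2)) := by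
  have hpos : ∀ η : UnitSphere (k + 2), 0 < ballPoissonKernel x η := fun η => by
    have h1 : x ≠ η := by
      rintro rfl
      simp [norm_eq_of_mem_sphere] at hx
    have h2 : 0 < ‖x - η‖ := norm_pos_iff.2 (sub_ne_zero.2 h1)
    have h3 : 0 < 1 - ‖x‖ ^ 2 := by nlinarith [norm_nonneg x]
    unfold ballPoissonKernel
    positivity
  rw [integral_pos_iff_support_of_nonneg (fun η => (hpos η).le)
    (integrable_of_continuous_sphere (continuous_ballPoissonKernel_sphere hx)).integrableOn]
  have : Function.support (fun η : UnitSphere (k + 2) => ballPoissonKernel x η) = univ :=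
    eq_univ_of_forall fun η => (hpos η).ne'
  rw [this, Measure.restrict_apply_univ]
  exact (ENNReal.toReal_pos_iff.1 hA).1

lemma surfaceMeasure_real_polarCap_capAngle {a : ℝ} (ha0 : -1 < a) (ha1 : a < 1)
    (ζ : UnitSphere (k + 2)) :
    (surfaceMeasure (k + 2)).real (polarCap ζ (capAngle (k + 2) ((a + 1) / 2))) =
      (a + 1) / 2 * (surfaceMeasure (k + 2)).real univ ∧
    (surfaceMeasure (k + 2)).real (polarCap ζ (capAngle (k + 2) ((a + 1) / 2)))ᶜ =
      (1 - a) / 2 * (surfaceMeasure (k + 2)).real univ := by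
  have h1 := (capAngle_spec (k := k) (c := (a + 1) / 2) (by linarith) (by linarith)).2 ζ
  have h2 := measureReal_add_measureReal_compl (μ := surfaceMeasure (k + 2))
    (isClosed_polarCap ζ (capAngle (k + 2) ((a + 1) / 2))).measurableSet
  exact ⟨h1, by linarith⟩

lemma abs_capPoisson_lt_one {a : ℝ} (ha0 : -1 < a) (ha1 : a < 1) (ζ : UnitSphere (k + 2))
    {x : EuclideanSpace ℝ (Fin (k + 2))} (hx : ‖x‖ < 1) :
    |capPoisson ζ (capAngle (k + 2) ((a + 1) / 2)) x| < 1 := by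
  have hM := surfaceMeasure_real_univ_pos k
  obtain ⟨hA, hAc⟩ := surfaceMeasure_real_polarCap_capAngle ha0 ha1 ζ
  have h1 := setIntegral_ballPoissonKernel_pos hx (hA.symm ▸ mul_pos (by linarith) hM)
  have h2 := setIntegral_ballPoissonKernel_pos hx (hAc.symm ▸ mul_pos (by linarith) hM)
  have h3 := integral_add_compl
    (isClosed_polarCap ζ (capAngle (k + 2) ((a + 1) / 2))).measurableSet
    (integrable_of_continuous_sphere (continuous_ballPoissonKernel_sphere hx))
  rw [integral_ballPoissonKernel hx] at h3
  have h4 := mul_pos (div_pos two_pos hM) h2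
  have h5 := mul_pos (div_pos two_pos hM) h1
  have h6 := congrArg (2 / (surfaceMeasure (k + 2)).real univ * ·) h3
  simp only [mul_add, div_mul_cancel₀ _ hM.ne'] at h6
  rw [abs_lt, capPoisson]
  constructor <;> linarith

lemma capPoisson_zero {a : ℝ} (ha0 : -1 < a) (ha1 : a < 1) (ζ : UnitSphere (k + 2)) :
    capPoisson ζ (capAngle (k + 2) ((a + 1) / 2)) 0 = a := by
  have hM := (surfaceMeasure_real_univ_pos k).ne'
  obtain ⟨-, hAc⟩ := surfaceMeasure_real_polarCap_capAngle ha0 ha1 ζ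
  have h1 : ∀ η : EuclideanSpace ℝ (Fin (k + 2)), ‖η‖ = 1 → ballPoissonKernel 0 η = 1 := by
    intro η hη; simp [ballPoissonKernel, hη]
  simp only [capPoisson, h1 _ (norm_eq_of_mem_sphere _), integral_const, smul_eq_mul, mul_one,
    measureReal_restrict_apply_univ, hAc]
  field_simp
  ring

/-- Along a radius the Poisson kernel decreases in the polar angle. -/
lemma ballPoissonKernel_smul_anti {n : ℕ} {r : ℝ} (hr0 : 0 ≤ r) (hr1 : r < 1)
    {s t : ℝ} (hs : 0 ≤ s) (hst : s ≤ t) (ht : t ≤ Real.pi) :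
    (1 - r ^ 2) * (√(1 - 2 * r * Real.cos t + r ^ 2) ^ n)⁻¹ ≤
      (1 - r ^ 2) * (√(1 - 2 * r * Real.cos s + r ^ 2) ^ n)⁻¹ := by
  have h1 : Real.cos t ≤ Real.cos s := Real.cos_le_cos_of_nonneg_of_le_pi hs ht hst
  have h2 : 0 < 1 - 2 * r * Real.cos s + r ^ 2 := by nlinarith [Real.cos_le_one s]
  have h3 : 0 < √(1 - 2 * r * Real.cos s + r ^ 2) := Real.sqrt_pos.2 h2
  have h4 : 0 ≤ 1 - r ^ 2 := by nlinarith
  gcongr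

/-- Among the functions with values in `[-1, 1]` and a prescribed mean on the sphere, the one that
is `1` on a polar cap and `-1` elsewhere has the greatest Poisson integral on the radius of the
cap. -/
lemma InnerProductSpace.HarmonicOnNhd.le_capPoisson_of_closedBall
    {u : EuclideanSpace ℝ (Fin (k + 2)) → ℝ} (hu : HarmonicOnNhd u (Metric.closedBall 0 1))
    (hb : ∀ x, ‖x‖ = 1 → |u x| ≤ 1) (ha0 : -1 < u 0) (ha1 : u 0 < 1) (ζ : UnitSphere (k + 2))
    {r : ℝ} (hr0 : 0 ≤ r) (hr1 : r < 1) :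
    u (r • (ζ : EuclideanSpace ℝ (Fin (k + 2)))) ≤
      capPoisson ζ (capAngle (k + 2) ((u 0 + 1) / 2)) (r • (ζ : EuclideanSpace ℝ (Fin (k + 2)))) := by
  set σ := surfaceMeasure (k + 2)
  set M := σ.real univ with hMdef
  have hM : 0 < M := surfaceMeasure_real_univ_pos k
  set α := capAngle (k + 2) ((u 0 + 1) / 2)
  have hα : α ∈ Ioo 0 Real.pi :=
    (capAngle_spec (k := k) (c := (u 0 + 1) / 2) (by linarith) (by linarith)).1
  have hAc : σ.real (polarCap ζ α)ᶜ = (1 - u 0) / 2 * M :=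
    (surfaceMeasure_real_polarCap_capAngle ha0 ha1 ζ).2
  have hAm : MeasurableSet (polarCap ζ α)ᶜ := (isClosed_polarCap ζ α).measurableSet.compl
  set x := r • (ζ : EuclideanSpace ℝ (Fin (k + 2))) with hxdef
  have hx : ‖x‖ < 1 := by
    rw [hxdef, norm_smul, norm_eq_of_mem_sphere, Real.norm_eq_abs, abs_of_nonneg hr0, mul_one]
    exact hr1
  have hPc := continuous_ballPoissonKernel_sphere hx
  set P : UnitSphere (k + 2) → ℝ := fun η => ballPoissonKernel x η
  have hP : Integrable P σ := integrable_of_continuous_sphere hPc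
  set g : UnitSphere (k + 2) → ℝ := fun η => 1 - u η with hgdef
  have hgc : Continuous g := continuous_const.sub hu.continuous_sphere
  have hg : Integrable g σ := integrable_of_continuous_sphere hgc
  have huη : Integrable (fun η : UnitSphere (k + 2) => u η) σ :=
    integrable_of_continuous_sphere hu.continuous_sphere
  have huP : Integrable (fun η : UnitSphere (k + 2) => u η * P η) σ :=
    integrable_of_continuous_sphere (hu.continuous_sphere.mul hPc)
  have hgP : Integrable (fun η => g η * P η) σ := integrable_of_continuous_sphere (hgc.mul hPc)
  have hux : u x = M⁻¹ * ∫ η : UnitSphere (k + 2), u η * P η ∂σ := hu.eq_poissonIntegral hx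
  have hu0 : M * u 0 = ∫ η : UnitSphere (k + 2), u η ∂σ := by
    rw [hu.eq_poissonIntegral (x := 0) (by simp), mul_inv_cancel_left₀ hM.ne']
    refine integral_congr_ae (.of_forall fun η => ?_)
    simp [ballPoissonKernel]
  have hgint : ∫ η, g η ∂σ = M * (1 - u 0) := by
    simp only [hgdef]
    rw [integral_sub (integrable_const _) huη, ← hu0]
    simp [← hMdef]
    ring
  have hgPint : ∫ η, g η * P η ∂σ = M * (1 - u x) := by
    have h1 : ∀ η, g η * P η = P η - u η * P η := fun η => by simp only [hgdef]; ring
    have h2 : ∫ η, P η ∂σ = M := integral_ballPoissonKernel hx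
    simp_rw [h1]
    rw [integral_sub hP huP, hux, h2]
    field_simp
  -- The value of the kernel on the boundary of the cap separates its values on the cap from those
  -- on the complement.
  set p : ℝ := (1 - r ^ 2) * (√(1 - 2 * r * Real.cos α + r ^ 2) ^ (k + 2))⁻¹
  have hle : ∀ η, (polarCap ζ α)ᶜ.indicator (fun η => 2 * (P η - p)) η ≤ g η * P η - p * g η := by
    intro η
    have hη1 := abs_le.1 (hb η (norm_eq_of_mem_sphere η))
    have hPη : P η = _ := ballPoissonKernel_smul r ζ η
    have ht0 := InnerProductGeometry.angle_nonneg (ζ : EuclideanSpace ℝ (Fin (k + 2))) η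
    have ht1 := InnerProductGeometry.angle_le_pi (ζ : EuclideanSpace ℝ (Fin (k + 2))) η
    by_cases hη : η ∈ polarCap ζ α
    · have h1 : p ≤ P η := hPη ▸ ballPoissonKernel_smul_anti hr0 hr1 ht0 hη hα.2.le
      simp only [indicator, mem_compl_iff, hη, not_true, if_false, hgdef]
      nlinarith
    · have h1 : P η ≤ p := hPη ▸ ballPoissonKernel_smul_anti hr0 hr1 hα.1.le
        (not_le.1 hη).le ht1
      simp only [indicator, mem_compl_iff, hη, not_false_eq_true, if_true, hgdef]
      nlinarith
  have hmono := integral_mono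
    (((hP.sub (integrable_const p)).const_mul 2).indicator hAm) (hgP.sub (hg.const_mul p)) hle
  simp only [Pi.sub_apply] at hmono
  rw [integral_indicator hAm, integral_const_mul,
    integral_sub hP.integrableOn (integrable_const _), integral_const,
    measureReal_restrict_apply_univ, hAc, integral_sub hgP (hg.const_mul p), integral_const_mul,
    hgint, hgPint, smul_eq_mul] at hmono
  have h2 : 2 * ∫ η in (polarCap ζ α)ᶜ, P η ∂σ ≤ M * (1 - u x) := by linarith
  have h3 : 2 / M * ∫ η in (polarCap ζ α)ᶜ, P η ∂σ ≤ 1 - u x := by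
    rw [div_mul_eq_mul_div, div_le_iff₀ hM]
    linarith
  change u x ≤ 1 - 2 / M * ∫ η in (polarCap ζ α)ᶜ, P η ∂σ
  linarith

/-- The harmonic Schwarz lemma: a harmonic function on the ball with values in `(-1, 1)` is bounded
on each radius by the extremal function with the same value at the center. -/
theorem InnerProductSpace.HarmonicOnNhd.le_capPoisson
    {u : EuclideanSpace ℝ (Fin (k + 2)) → ℝ} (hu : HarmonicOnNhd u (Metric.ball 0 1))
    (hb : ∀ x, ‖x‖ < 1 → |u x| < 1) (ζ : UnitSphere (k + 2))
    {r : ℝ} (hr0 : 0 ≤ r) (hr1 : r < 1) :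
    u (r • (ζ : EuclideanSpace ℝ (Fin (k + 2)))) ≤
      capPoisson ζ (capAngle (k + 2) ((u 0 + 1) / 2)) (r • (ζ : EuclideanSpace ℝ (Fin (k + 2)))) := by
  set x := r • (ζ : EuclideanSpace ℝ (Fin (k + 2))) with hxdef
  have hx : ‖x‖ < 1 := by
    rw [hxdef, norm_smul, norm_eq_of_mem_sphere, Real.norm_eq_abs, abs_of_nonneg hr0, mul_one]
    exact hr1
  -- The dilates of `u` are harmonic near the closed ball and converge to `u` at `x`.
  have hlim : Tendsto (fun R : ℝ => u (R • x)) (𝓝[<] 1) (𝓝 (u x)) := by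
    have h1 : ContinuousAt u x := (hu x (by simpa using hx)).1.continuousAt
    have h2 : Tendsto (fun R : ℝ => R • x) (𝓝 1) (𝓝 x) := by
      have : Continuous fun R : ℝ => R • x := by fun_prop
      simpa using this.tendsto 1
    exact h1.tendsto.comp (h2.mono_left nhdsWithin_le_nhds)
  refine le_of_tendsto hlim ?_
  filter_upwards [self_mem_nhdsWithin, nhdsWithin_le_nhds (lt_mem_nhds zero_lt_one)] with R hR1 hR0
  have hR1' : R < 1 := hR1
  have hlt : ∀ y : EuclideanSpace ℝ (Fin (k + 2)), ‖y‖ ≤ 1 → ‖R • y‖ < 1 := fun y hy => by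
    rw [norm_smul, Real.norm_eq_abs, abs_of_pos hR0]
    nlinarith [norm_nonneg y]
  have huR : HarmonicOnNhd (fun y => u (R • y)) (Metric.closedBall 0 1) := fun y hy =>
    HarmonicAt.comp_smul (hu _ (by simpa using hlt y (by simpa using hy)))
  have h0 := abs_lt.1 (hb 0 (by simp))
  have := huR.le_capPoisson_of_closedBall (fun y hy => (hb _ (hlt y hy.le)).le)
    (by simpa using h0.1) (by simpa using h0.2) ζ hr0 hr1
  simpa using this

end Schwarz

/-! ### Boundary derivatives -/

lemma HasDerivWithinAt.le_of_le_on_Ioo {φ ψ : ℝ → ℝ} {φ' ψ' ε : ℝ} (hε : 0 < ε)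
    (hφ : HasDerivWithinAt φ φ' (Ioo 0 ε) 0) (hψ : HasDerivWithinAt ψ ψ' (Ioo 0 ε) 0)
    (h0 : φ 0 = ψ 0) (hle : ∀ t ∈ Ioo 0 ε, φ t ≤ ψ t) : φ' ≤ ψ' := by
  have hnot : (0 : ℝ) ∉ Ioo 0 ε := by simp
  rw [hasDerivWithinAt_iff_tendsto_slope' hnot] at hφ hψ
  have : (𝓝[Ioo 0 ε] (0 : ℝ)).NeBot := by
    rw [nhdsWithin_Ioo_eq_nhdsGT hε]; infer_instance
  refine le_of_tendsto_of_tendsto hφ hψ ?_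
  filter_upwards [self_mem_nhdsWithin] with t ht
  have ht0 : 0 < t := ht.1
  rw [slope_def_field, slope_def_field, h0]
  have := hle t ht
  gcongr

/-- A linear functional that is nonpositive on all directions pointing into the unit ball at `x₀` is
a multiple of the inner product with `x₀`. -/
lemma eq_smul_of_inner_nonpos {V : Type*} [NormedAddCommGroup V] [InnerProductSpace ℝ V]
    {x₀ g : V} (hx₀ : ‖x₀‖ = 1) (h : ∀ v, inner ℝ x₀ v < 0 → inner ℝ g v ≤ 0) :
    g = inner ℝ g x₀ • x₀ := by
  set l := inner ℝ g x₀
  set w := g - l • x₀ with hw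
  have hwx : inner ℝ x₀ w = 0 := by
    rw [hw, inner_sub_right, real_inner_smul_right, real_inner_self_eq_norm_sq, hx₀,
      real_inner_comm]
    simp [l]
  have hgw : inner ℝ g w = ‖w‖ ^ 2 := by
    have h1 : g = w + l • x₀ := by rw [hw]; abel
    rw [h1, inner_add_left, real_inner_smul_left, hwx, real_inner_self_eq_norm_sq]
    ring
  have hs : ∀ s : ℝ, 0 < s → ‖w‖ ^ 2 ≤ s * l := fun s hs => by
    have h1 := h (w - s • x₀) (by
      rw [inner_sub_right, hwx, real_inner_smul_right, real_inner_self_eq_norm_sq, hx₀]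
      linarith)
    rw [inner_sub_right, hgw, real_inner_smul_right] at h1
    linarith
  have hlim : Tendsto (fun s : ℝ => s * l) (𝓝[>] 0) (𝓝 0) := by
    have : Continuous fun s : ℝ => s * l := by fun_prop
    simpa using (this.tendsto 0).mono_left nhdsWithin_le_nhds
  have h0 : ‖w‖ ^ 2 ≤ 0 := by
    refine ge_of_tendsto hlim ?_
    filter_upwards [self_mem_nhdsWithin] with s h using hs s h
  have hw0 : w = 0 := by
    rw [← norm_eq_zero]
    nlinarith [norm_nonneg w]
  rwa [hw, sub_eq_zero] at hw0

lemma exists_add_smul_mem_ball {V : Type*} [NormedAddCommGroup V] [InnerProductSpace ℝ V]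
    {x₀ v : V} (hx₀ : ‖x₀‖ = 1) (hv : inner ℝ x₀ v < 0) :
    ∃ ε > 0, ∀ t ∈ Ioo (0 : ℝ) ε, x₀ + t • v ∈ Metric.ball (0 : V) 1 := by
  refine ⟨-inner ℝ x₀ v / (‖v‖ ^ 2 + 1), div_pos (by linarith) (by positivity), fun t ht => ?_⟩
  have h1 := (lt_div_iff₀ (by positivity : 0 < ‖v‖ ^ 2 + 1)).1 ht.2
  have h2 : ‖x₀ + t • v‖ ^ 2 < 1 := by
    rw [norm_add_sq_real, real_inner_smul_right, norm_smul, hx₀, mul_pow, Real.norm_eq_abs, sq_abs]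
    nlinarith [ht.1, mul_pos ht.1 ht.1]
  rw [mem_ball_zero_iff]
  nlinarith [norm_nonneg (x₀ + t • v)]

section Main

variable {k m : ℕ}

lemma hasDerivAt_capPoisson_radius {a : ℝ} (ha0 : -1 < a) (ha1 : a < 1) (ζ : UnitSphere (k + 2)) :
    HasDerivAt (fun r : ℝ => capPoisson ζ (capAngle (k + 2) ((a + 1) / 2))
      (r • (ζ : EuclideanSpace ℝ (Fin (k + 2))))) (schwarzConst (k + 2) a) 1 := by
  obtain ⟨hα, -⟩ := capAngle_spec (k := k) (c := (a + 1) / 2) (by linarith) (by linarith)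
  have h1 := hasFDerivAt_capPoisson_center hα.1 hα.2 ζ
  rw [← schwarzConst_eq] at h1
  have h2 : HasDerivAt (fun r : ℝ => r • (ζ : EuclideanSpace ℝ (Fin (k + 2))))
      (ζ : EuclideanSpace ℝ (Fin (k + 2))) 1 := by
    simpa using (hasDerivAt_id (1 : ℝ)).smul_const (ζ : EuclideanSpace ℝ (Fin (k + 2)))
  rw [← one_smul ℝ (ζ : EuclideanSpace ℝ (Fin (k + 2)))] at h1
  refine (h1.comp_hasDerivAt (1 : ℝ) h2).congr_deriv ?_
  simp [norm_eq_of_mem_sphere]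

variable {f : EuclideanSpace ℝ (Fin (k + 2)) → EuclideanSpace ℝ (Fin m)}
  {x₀ : EuclideanSpace ℝ (Fin (k + 2))} {y₀ : EuclideanSpace ℝ (Fin m)}

lemma IsHarmonicBallMap.harmonicOnNhd_inner (hf : IsHarmonicBallMap f)
    (y₀ : EuclideanSpace ℝ (Fin m)) :
    HarmonicOnNhd (fun x => inner ℝ y₀ (f x)) (Metric.ball 0 1) :=
  hf.1.comp_CLM (innerSL ℝ y₀)

lemma IsHarmonicBallMap.abs_inner_lt_one (hf : IsHarmonicBallMap f) (hy₀ : ‖y₀‖ = 1)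
    {x : EuclideanSpace ℝ (Fin (k + 2))} (hx : ‖x‖ < 1) : |inner ℝ y₀ (f x)| < 1 := by
  have h1 := abs_real_inner_le_norm y₀ (f x)
  have h2 : ‖f x‖ < 1 := by simpa using hf.2 (show x ∈ Metric.ball 0 1 by simpa using hx)
  rw [hy₀, one_mul] at h1
  exact h1.trans_lt h2

lemma IsHarmonicBallMap.inner_le_capPoisson (hf : IsHarmonicBallMap f) (hy₀ : ‖y₀‖ = 1)
    (ζ : UnitSphere (k + 2)) {r : ℝ} (hr0 : 0 ≤ r) (hr1 : r < 1) :
    inner ℝ y₀ (f (r • (ζ : EuclideanSpace ℝ (Fin (k + 2))))) ≤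
      capPoisson ζ (capAngle (k + 2) ((inner ℝ (f 0) y₀ + 1) / 2))
        (r • (ζ : EuclideanSpace ℝ (Fin (k + 2)))) := by
  rw [real_inner_comm y₀ (f 0)]
  exact (hf.harmonicOnNhd_inner y₀).le_capPoisson (fun x hx => hf.abs_inner_lt_one hy₀ hx) ζ hr0 hr1

/-- The lower bound for the upper limit: by the mean value theorem on `[r, 1]` the radial derivative
takes values at least as large as the difference quotient of the extremal function. -/
theorem IsHarmonicBallMap.schwarzConst_le_limsup (hf : IsHarmonicBallMap f) (hx₀ : ‖x₀‖ = 1)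
    (hy₀ : ‖y₀‖ = 1) (hfx : f x₀ = y₀) (hc : ContinuousWithinAt f (Metric.ball 0 1) x₀) :
    ((schwarzConst (k + 2) (inner ℝ (f 0) y₀) : ℝ) : EReal) ≤ limsupRadialDeriv f x₀ := by
  set a := inner ℝ (f 0) y₀
  have ha := abs_lt.1 (hf.abs_inner_lt_one hy₀ (x := 0) (by simp))
  rw [real_inner_comm] at ha
  set ζ : UnitSphere (k + 2) := ⟨x₀, by simpa using hx₀⟩
  set U : ℝ → ℝ := fun r => capPoisson ζ (capAngle (k + 2) ((a + 1) / 2)) (r • x₀)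
  have hU : HasDerivAt U (schwarzConst (k + 2) a) 1 := hasDerivAt_capPoisson_radius ha.1 ha.2 ζ
  have hU1 : U 1 = 1 := by
    simp only [U, one_smul]; exact capPoisson_center ζ _
  set φ : ℝ → ℝ := fun r => inner ℝ y₀ (f (r • x₀))
  have hφ1 : φ 1 = 1 := by simp [φ, hfx, hy₀]
  have hφU : ∀ r, 0 ≤ r → r < 1 → φ r ≤ U r := fun r h0 h1 => hf.inner_le_capPoisson hy₀ ζ h0 h1
  have hball : ∀ r : ℝ, 0 < r → r < 1 → r • x₀ ∈ Metric.ball (0 : EuclideanSpace ℝ (Fin (k + 2))) 1 :=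
    fun r h0 h1 => by simpa [norm_smul, hx₀, abs_of_pos h0] using h1
  have hφd : ∀ r, 0 < r → r < 1 → HasDerivAt φ (inner ℝ y₀ (fderiv ℝ f (r • x₀) x₀)) r := by
    intro r h0 h1
    have hd : HasFDerivAt f (fderiv ℝ f (r • x₀)) (r • x₀) :=
      ((hf.1 _ (hball r h0 h1)).1.differentiableAt (by simp)).hasFDerivAt
    have h2 : HasDerivAt (fun r : ℝ => r • x₀) x₀ r := by
      simpa using (hasDerivAt_id r).smul_const x₀
    exact (innerSL ℝ y₀).hasFDerivAt.comp_hasDerivAt r (hd.comp_hasDerivAt r h2)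
  have hφc : ∀ r, 0 < r → ContinuousOn φ (Icc r 1) := by
    intro r h0 t ht
    rcases ht.2.lt_or_eq with h1 | rfl
    · exact (hφd t (h0.trans_le ht.1) h1).continuousAt.continuousWithinAt
    · have h2 : ContinuousWithinAt f (insert x₀ (Metric.ball 0 1)) x₀ := hc.insert
      have h3 : ContinuousWithinAt (fun r : ℝ => r • x₀) (Icc r 1) 1 :=
        Continuous.continuousWithinAt (by fun_prop)
      have h4 : MapsTo (fun r : ℝ => r • x₀) (Icc r 1) (insert x₀ (Metric.ball 0 1)) := by
        intro s hs
        rcases hs.2.lt_or_eq with h | rfl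
        · exact mem_insert_of_mem _ (hball s (h0.trans_le hs.1) h)
        · simp
      have h5 : ContinuousWithinAt (fun r : ℝ => f (r • x₀)) (Icc r 1) 1 :=
        ContinuousWithinAt.comp (g := f) (t := insert x₀ (Metric.ball 0 1)) (by simpa using h2) h3 h4
      exact (innerSL ℝ y₀).continuous.continuousAt.comp_continuousWithinAt h5
  have hslope : Tendsto (slope U 1) (𝓝[<] 1) (𝓝 (schwarzConst (k + 2) a)) :=
    (hasDerivAt_iff_tendsto_slope.1 hU).mono_left
      (nhdsWithin_mono _ fun r (hr : r < 1) => hr.ne)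
  rw [← EReal.ge_of_forall_gt_iff_ge]
  intro b hb
  have hb' : b < schwarzConst (k + 2) a := by exact_mod_cast hb
  refine le_limsup_of_frequently_le ?_
  intro hnot
  obtain ⟨r₁, hr₁, hIoo⟩ := (mem_nhdsLT_iff_exists_Ioo_subset (a := (1 : ℝ))).1 hnot
  have hr₁' : r₁ < 1 := hr₁
  obtain ⟨r, ⟨⟨hrs, hr0⟩, hrr₁⟩, hr1⟩ := (((hslope.eventually (lt_mem_nhds hb')).and
    (nhdsWithin_le_nhds (lt_mem_nhds zero_lt_one))).and
    (nhdsWithin_le_nhds (lt_mem_nhds hr₁'))).and self_mem_nhdsWithin |>.exists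
  have hr1' : r < 1 := hr1
  obtain ⟨ξ, hξ, hξd⟩ := exists_hasDerivAt_eq_slope φ _ hr1' (hφc r hr0)
    fun t ht => hφd t (hr0.trans ht.1) ht.2
  refine hIoo ⟨hrr₁.trans hξ.1, hξ.2⟩ ?_
  have hξ0 : 0 < ξ := hr0.trans hξ.1
  have h1 : radialDeriv f (ξ • x₀) = fderiv ℝ f (ξ • x₀) x₀ := by
    rw [radialDeriv, norm_smul, hx₀, mul_one, Real.norm_eq_abs, abs_of_pos hξ0, smul_smul,
      inv_mul_cancel₀ hξ0.ne', one_smul]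
  have h2 : b ≤ ‖radialDeriv f (ξ • x₀)‖ := by
    calc b ≤ slope U 1 r := hrs.le
      _ = (1 - U r) / (1 - r) := by
        rw [slope_def_field, hU1, ← neg_div_neg_eq, neg_sub, neg_sub]
      _ ≤ (φ 1 - φ r) / (1 - r) := by
        rw [hφ1]
        have := hφU r hr0.le hr1'
        have : 0 < 1 - r := by linarith
        gcongr
      _ = inner ℝ y₀ (fderiv ℝ f (ξ • x₀) x₀) := hξd.symm
      _ ≤ ‖y₀‖ * ‖fderiv ℝ f (ξ • x₀) x₀‖ := real_inner_le_norm _ _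
      _ = ‖radialDeriv f (ξ • x₀)‖ := by rw [hy₀, one_mul, h1]
  exact_mod_cast h2

/-- The bound for the boundary derivative: in directions pointing into the ball `⟪y₀, f⟫` stays below
its value `1` at `x₀`, and along the radius it stays below the extremal function. -/
theorem IsHarmonicBallMap.adjoint_fderiv_eq_smul (hf : IsHarmonicBallMap f) (hx₀ : ‖x₀‖ = 1)
    (hy₀ : ‖y₀‖ = 1) (hfx : f x₀ = y₀)
    {L : EuclideanSpace ℝ (Fin (k + 2)) →L[ℝ] EuclideanSpace ℝ (Fin m)}
    (hL : HasFDerivWithinAt f L (Metric.ball 0 1) x₀) :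
    ∃ lam : ℝ, 0 < lam ∧ ContinuousLinearMap.adjoint L y₀ = lam • x₀ ∧
      schwarzConst (k + 2) (inner ℝ (f 0) y₀) ≤ lam := by
  set a := inner ℝ (f 0) y₀
  have ha := abs_lt.1 (hf.abs_inner_lt_one hy₀ (x := 0) (by simp))
  rw [real_inner_comm] at ha
  set ζ : UnitSphere (k + 2) := ⟨x₀, by simpa using hx₀⟩
  set g := ContinuousLinearMap.adjoint L y₀
  have hgv : ∀ v, inner ℝ g v = inner ℝ y₀ (L v) := fun v =>
    ContinuousLinearMap.adjoint_inner_left L v y₀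
  have hline : ∀ v (ε : ℝ), (∀ t ∈ Ioo (0 : ℝ) ε, x₀ + t • v ∈
      Metric.ball (0 : EuclideanSpace ℝ (Fin (k + 2))) 1) →
      HasDerivWithinAt (fun t : ℝ => inner ℝ y₀ (f (x₀ + t • v))) (inner ℝ g v) (Ioo 0 ε) 0 := by
    intro v ε hε
    have h1 : HasFDerivWithinAt f L (Metric.ball 0 1) (x₀ + (0 : ℝ) • v) := by simpa using hL
    have h2 := h1.comp_hasDerivWithinAt (0 : ℝ)
      (hasDerivAt_add_smul x₀ v 0).hasDerivWithinAt hε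
    rw [hgv]
    exact (innerSL ℝ y₀).hasFDerivAt.comp_hasDerivWithinAt (0 : ℝ) h2
  have hφ0 : ∀ v : EuclideanSpace ℝ (Fin (k + 2)), inner ℝ y₀ (f (x₀ + (0 : ℝ) • v)) = 1 := by
    intro v; simp [hfx, hy₀]
  have hneg : ∀ v, inner ℝ x₀ v < 0 → inner ℝ g v ≤ 0 := by
    intro v hv
    obtain ⟨ε, hε, hmem⟩ := exists_add_smul_mem_ball hx₀ hv
    refine (hline v ε hmem).le_of_le_on_Ioo hε (hasDerivWithinAt_const _ _ (1 : ℝ)) (hφ0 v) ?_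
    intro t ht
    exact (abs_lt.1 (hf.abs_inner_lt_one hy₀ (by simpa using hmem t ht))).2.le
  have hrad : ∀ t : ℝ, x₀ + t • (-x₀) = (1 - t) • x₀ := fun t => by
    rw [sub_smul, one_smul, smul_neg, sub_eq_add_neg]
  have hlam : schwarzConst (k + 2) a ≤ inner ℝ g x₀ := by
    have h1 : HasDerivWithinAt (fun t : ℝ => capPoisson ζ (capAngle (k + 2) ((a + 1) / 2))
        ((1 - t) • x₀)) (-schwarzConst (k + 2) a) (Ioo 0 1) 0 := by
      have h2 := hasDerivAt_capPoisson_radius ha.1 ha.2 ζ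
      have h3 := h2.comp_of_eq (0 : ℝ) ((hasDerivAt_id (0 : ℝ)).const_sub 1) (by simp)
      exact (h3.congr_deriv (by ring)).hasDerivWithinAt
    have hmem : ∀ t ∈ Ioo (0 : ℝ) 1, x₀ + t • (-x₀) ∈
        Metric.ball (0 : EuclideanSpace ℝ (Fin (k + 2))) 1 := fun t ht => by
      rw [hrad, mem_ball_zero_iff, norm_smul, hx₀, mul_one, Real.norm_eq_abs, abs_lt]
      constructor <;> linarith [ht.1, ht.2]
    have h4 := (hline (-x₀) 1 hmem).le_of_le_on_Ioo one_pos h1 (by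
        rw [hφ0, sub_zero, one_smul]; exact (capPoisson_center ζ _).symm) fun t ht => by
      rw [hrad]
      exact hf.inner_le_capPoisson hy₀ ζ (by linarith [ht.2]) (by linarith [ht.1])
    rw [inner_neg_right] at h4
    linarith
  exact ⟨inner ℝ g x₀, (schwarzConst_pos ha.1 ha.2).trans_le hlam,
    eq_smul_of_inner_nonpos hx₀ hneg, hlam⟩

/-- Sharpness: the extremal function in the direction of `y₀` attains both bounds. -/
theorem exists_isHarmonicBallMap_extremal (hx₀ : ‖x₀‖ = 1) (hy₀ : ‖y₀‖ = 1) {a : ℝ} (ha0 : -1 < a)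
    (ha1 : a < 1) :
    ∃ (f : EuclideanSpace ℝ (Fin (k + 2)) → EuclideanSpace ℝ (Fin m))
      (L : EuclideanSpace ℝ (Fin (k + 2)) →L[ℝ] EuclideanSpace ℝ (Fin m)),
      IsHarmonicBallMap f ∧ inner ℝ (f 0) y₀ = a ∧ f x₀ = y₀ ∧ HasFDerivAt f L x₀ ∧
        limsupRadialDeriv f x₀ = ((schwarzConst (k + 2) a : ℝ) : EReal) ∧
        ContinuousLinearMap.adjoint L y₀ = schwarzConst (k + 2) a • x₀ := by
  set ζ : UnitSphere (k + 2) := ⟨x₀, by simpa using hx₀⟩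
  set α := capAngle (k + 2) ((a + 1) / 2)
  obtain ⟨hα, -⟩ := capAngle_spec (k := k) (c := (a + 1) / 2) (by linarith) (by linarith)
  set D := schwarzConst (k + 2) a
  have hDpos : 0 < D := schwarzConst_pos ha0 ha1
  set f : EuclideanSpace ℝ (Fin (k + 2)) → EuclideanSpace ℝ (Fin m) :=
    fun x => capPoisson ζ α x • y₀
  have hyy : inner ℝ y₀ y₀ = (1 : ℝ) := by rw [real_inner_self_eq_norm_sq, hy₀, one_pow]
  have hU : HasFDerivAt (capPoisson ζ α) (D • innerSL ℝ x₀) x₀ := by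
    have h := hasFDerivAt_capPoisson_center hα.1 hα.2 ζ
    rwa [← schwarzConst_eq] at h
  have hfd : HasFDerivAt f ((D • innerSL ℝ x₀).smulRight y₀) x₀ := hU.smul_const y₀
  have hfh : HarmonicOnNhd f
      (awayFrom ((surfaceMeasure (k + 2)).restrict (polarCap ζ α)ᶜ)) :=
    (harmonicOnNhd_capPoisson ζ α).comp_CLM ((ContinuousLinearMap.id ℝ ℝ).smulRight y₀)
  have hcont : ContinuousAt (fderiv ℝ f) x₀ :=
    ((hfh x₀ (center_mem_awayFrom hα.1 hα.2 ζ)).1.fderiv_right (m := 1) (by norm_num)).continuousAt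
  refine ⟨f, _, ⟨hfh.mono (ball_subset_awayFrom _), fun x hx => ?_⟩, ?_, ?_, hfd, ?_, ?_⟩
  · rw [mem_ball_zero_iff] at hx ⊢
    simpa [f, norm_smul, hy₀] using abs_capPoisson_lt_one ha0 ha1 ζ hx
  · simp only [f]
    rw [real_inner_smul_left, hyy, mul_one, capPoisson_zero ha0 ha1]
  · simp only [f]
    rw [show capPoisson ζ α x₀ = 1 from capPoisson_center ζ α, one_smul]
  · have h1 : Tendsto (fun r : ℝ => r • x₀) (𝓝[<] 1) (𝓝 x₀) := by
      have : Continuous fun r : ℝ => r • x₀ := by fun_prop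
      simpa using (this.tendsto 1).mono_left nhdsWithin_le_nhds
    have h2 : Tendsto (fun r : ℝ => ‖fderiv ℝ f (r • x₀) x₀‖) (𝓝[<] 1) (𝓝 D) := by
      have h3 := (((ContinuousLinearMap.apply ℝ (EuclideanSpace ℝ (Fin m))
        x₀).continuous.tendsto (fderiv ℝ f x₀)).comp (hcont.tendsto.comp h1)).norm
      rw [hfd.fderiv] at h3
      simpa [Function.comp_def, norm_smul, hx₀, hy₀, abs_of_pos hDpos] using h3
    have h4 : (fun r : ℝ => ((‖radialDeriv f (r • x₀)‖ : ℝ) : EReal)) =ᶠ[𝓝[<] 1]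
        fun r => ((‖fderiv ℝ f (r • x₀) x₀‖ : ℝ) : EReal) := by
      filter_upwards [nhdsWithin_le_nhds (lt_mem_nhds zero_lt_one)] with r hr
      have hr' : 0 < r := hr
      rw [radialDeriv, norm_smul, hx₀, mul_one, Real.norm_eq_abs, abs_of_pos hr', smul_smul,
        inv_mul_cancel₀ hr'.ne', one_smul]
    rw [limsupRadialDeriv, limsup_congr h4]
    exact ((continuous_coe_real_ereal.tendsto D).comp h2).limsup_eq
  · refine ext_inner_right ℝ fun v => ?_
    rw [ContinuousLinearMap.adjoint_inner_left]
    simp [real_inner_smul_right, real_inner_smul_left, hy₀]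

end Main

theorem mainTheorem4 (n m : ℕ) (hn : 2 ≤ n)
    (x₀ : EuclideanSpace ℝ (Fin n)) (hx₀ : ‖x₀‖ = 1)
    (y₀ : EuclideanSpace ℝ (Fin m)) (hy₀ : ‖y₀‖ = 1) :
    -- the two lower bounds
    (∀ (f : EuclideanSpace ℝ (Fin n) → EuclideanSpace ℝ (Fin m))
        (a₀ : EuclideanSpace ℝ (Fin m)),
      IsHarmonicBallMap f → f 0 = a₀ →
      f x₀ = y₀ → ContinuousWithinAt f (Metric.ball 0 1) x₀ →
        ((schwarzConst n (inner ℝ a₀ y₀) : ℝ) : EReal) ≤ limsupRadialDeriv f x₀ ∧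
        ∀ L : EuclideanSpace ℝ (Fin n) →L[ℝ] EuclideanSpace ℝ (Fin m),
          HasFDerivWithinAt f L (Metric.ball 0 1) x₀ →
            ∃ lam : ℝ, 0 < lam ∧ ContinuousLinearMap.adjoint L y₀ = lam • x₀ ∧
              schwarzConst n (inner ℝ a₀ y₀) ≤ lam) ∧
    -- sharpness: for every admissible value of `a`, both bounds are attained
    (∀ a : ℝ, -1 < a → a < 1 →
      ∃ (f : EuclideanSpace ℝ (Fin n) → EuclideanSpace ℝ (Fin m))
        (L : EuclideanSpace ℝ (Fin n) →L[ℝ] EuclideanSpace ℝ (Fin m)),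
        IsHarmonicBallMap f ∧ inner ℝ (f 0) y₀ = a ∧ f x₀ = y₀ ∧ HasFDerivAt f L x₀ ∧
          limsupRadialDeriv f x₀ = ((schwarzConst n a : ℝ) : EReal) ∧
          ContinuousLinearMap.adjoint L y₀ = schwarzConst n a • x₀) := by
  obtain ⟨k, rfl⟩ := Nat.exists_eq_add_of_le' hn
  refine ⟨?_, fun a ha0 ha1 => exists_isHarmonicBallMap_extremal hx₀ hy₀ ha0 ha1⟩
  rintro f _ hf rfl hfx hc
  exact ⟨hf.schwarzConst_le_limsup hx₀ hy₀ hfx hc,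
    fun L hL => hf.adjoint_fderiv_eq_smul hx₀ hy₀ hfx hL⟩
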